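/- **Setting.** Let $S$ be a closed connected orientable surface of genus $g$ with a finite set of $p$ marked points, and $\chi(S)=2-2g-p$. A quadratic differential $q$ on $S$ is a Euclidean cone metric with finitely many cone points, of angles $k\pi$ with $k\ge 1$ an integer and $k\ge 2$ at unmarked points, with preferred coordinates off the singularities (the cone points of angle $\neq 2\pi$) that are well defined up to $z\mapsto \pm z+c$; horizontal and vertical lines define its horizontal and vertical foliations. A homeomorphism $\phi:S\to S$ preserving the marked points is pseudo-Anosov with dilatation $\lambda(\phi)=\lambda>1$ if for some $q$ it is given in preferred coordinates by $(x,y)\mapsto(\lambda x+c,\,y/\lambda+c')$. For $P\ge 1$ let $\Psi_P$ be the set of all pseudo-Anosov $\phi:S\to S$, over all such $S$ with $\chi(S)<0$, satisfying $\lambda(\phi)\le P^{1/|\chi(S)|}$. A rectangle is (the image $R$ of) a map $\rho:[0,1]^2\to S$, affine in preferred coordinates, taking horizontal (vertical) segments to horizontal (vertical) leaf arcs, possibly meeting singularities only on the boundary, and taking the open square injectively onto an open set $\mathrm{int}(R)$; $\partial_vR=\rho(\{0,1\}\times[0,1])$ and $\partial_hR=\rho([0,1]\times\{0,1\})$. A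 Markov partition for $\phi$ is a finite set $\mathcal R$ of rectangles with pairwise disjoint interiors, covering $S$, with $\phi(\bigcup\partial_vR)\subseteq\bigcup\partial_vR$ and $\phi^{-1}(\bigcup\partial_hR)\subseteq\bigcup\partial_hR$, and such that every marked point lies on the boundary of some rectangle. It is small if $|\mathcal R|\le 9|\chi(S)|$. A rectangle $R\in\mathcal R$ is unmixed by $\phi$ if $\phi$ maps it homeomorphically onto some $R'\in\mathcal R$ (interior onto interior), and mixed otherwise. A target of $R$ is an $R'\in\mathcal R$ with $\phi^{-1}(\mathrm{int}\,R')\cap R\ne\emptyset$. The degree $\deg(R)$ is the number of connected components of $\phi^{-1}\big(\bigcup_{R'\in\mathcal R}\mathrm{int}\,R'\big)\cap R$, and the codegree is $\mathrm{codeg}(R)=\sum\deg(R')$ over all $R'\in\mathcal R$ that have $R$ as a target. **Lemma.** For every real $P\ge 1$ there is an integer $C=C(P)>0$, depending only on $P$, such that for every $(\phi:S\to S)\in\Psi_P$ and every small Markov partition $\mathcal R$ for $\phi$: at most $C$ rectangles of $\mathcal R$ are mixed by $\phi$; the sum of the degrees of the mixed rectangles is at most $C$; and the sum of the codegrees of all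 targets of mixed rectangles is at most $C$. The last two bounds also hold if in the definition of the degree (and hence of the codegree) the components are counted in $\mathrm{int}(R)$ instead of $R$. -/

import Mathlib

open Set Filter Topology

universe u

namespace SmallDilatation

noncomputable section

/-! ### Euler characteristic of a marked surface -/

/-- The `i`-th rational Betti number of `X` (rank of singular homology with `ℚ` coefficients). -/
def betti (X : Type u) [TopologicalSpace X] (i : ℕ) : ℕ :=
  Module.finrank ℚ
    (((AlgebraicTopology.singularHomologyFunctor (ModuleCat.{u} ℚ) i).obj
      (ModuleCat.of ℚ (ULift.{u} ℚ))).obj (TopCat.of X))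

/-- The Euler characteristic of a closed surface `S` with a finite set `M` of marked points:
`χ = (b₀ - b₁ + b₂) - |M|`, that is `2 - 2g - p` for genus `g` and `p` marked points. -/
def eulerChar (S : Type u) [TopologicalSpace S] (M : Finset S) : ℤ :=
  (betti S 0 : ℤ) - betti S 1 + betti S 2 - M.card

/-! ### Flat cone structures (quadratic differentials) -/

/-- Along the filter `l`, the complex function `f` is `±g + const`. -/
def EqUpToSignAndTranslation {α : Type*} (l : Filter α) (f g : α → ℂ) : Prop :=
  ∃ ε c : ℂ, (ε = 1 ∨ ε = -1) ∧ ∀ᶠ x in l, f x = ε * g x + c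

/-- The data of a quadratic differential on `S`, marked at `M`, as a Euclidean cone structure:
a finite set of singular points, and off it an atlas of preferred coordinates in `ℂ` whose
changes of coordinates are locally `z ↦ ±z + c`. Near a singular point there is a coordinate
`ψ` centred at it in which the preferred coordinates are, up to translation, the branches of
`ψ ^ (k / 2)`: this is a cone point of angle `kπ`. Here `k ≥ 1`, and `k ≥ 2` at unmarked points;
`k ≠ 2` because points of cone angle `2π` are not singular. The horizontal (vertical) foliation
is given by the horizontal (vertical) lines of the preferred coordinates.

On a nonempty connected compact Hausdorff space, the existence of such a structure makes `S` a
closed connected orientable surface. -/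
structure FlatConeStructure (S : Type u) [TopologicalSpace S] (M : Finset S) where
  /-- The singular points. -/
  sing : Set S
  finite_sing : sing.Finite
  /-- The preferred coordinate charts. -/
  charts : Set (OpenPartialHomeomorph S ℂ)
  source_subset : ∀ e ∈ charts, e.source ⊆ singᶜ
  covers : ∀ p ∉ sing, ∃ e ∈ charts, p ∈ e.source
  compatible : ∀ e ∈ charts, ∀ e' ∈ charts, ∀ p ∈ e.source ∩ e'.source,
    EqUpToSignAndTranslation (𝓝 p) e' e
  cone : ∀ p ∈ sing, ∃ k : ℕ, 1 ≤ k ∧ k ≠ 2 ∧ (p ∉ M → 2 ≤ k) ∧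
    ∃ ψ : OpenPartialHomeomorph S ℂ, p ∈ ψ.source ∧ ψ p = 0 ∧ ψ.source ∩ sing = {p} ∧
      ∀ e ∈ charts, ∀ x ∈ e.source ∩ ψ.source,
        ∃ c : ℂ, ∀ᶠ y in 𝓝 x, (e y - c) ^ 2 = ψ y ^ k

/-! ### Pseudo-Anosov homeomorphisms -/

/-- A pseudo-Anosov homeomorphism `φ` of the marked surface `(S, M)`, with a quadratic
differential `q` and dilatation `λ > 1` for which `φ` is
`(x, y) ↦ (λ x + c, y / λ + c')` in preferred coordinates. (Preferred coordinates are only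
determined up to sign, so for arbitrary charts around a point and its image the formula holds
up to a common sign.) -/
structure PseudoAnosov (S : Type u) [TopologicalSpace S] (M : Finset S) where
  /-- The homeomorphism. -/
  φ : S ≃ₜ S
  map_marked : ∀ p, φ p ∈ M ↔ p ∈ M
  /-- The quadratic differential. -/
  q : FlatConeStructure S M
  map_sing : ∀ p, φ p ∈ q.sing ↔ p ∈ q.sing
  /-- The dilatation. -/
  dilatation : ℝ
  one_lt_dilatation : 1 < dilatation
  affine : ∀ e ∈ q.charts, ∀ e' ∈ q.charts, ∀ p ∈ e.source, φ p ∈ e'.source →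
    EqUpToSignAndTranslation (𝓝 p) (fun x => e' (φ x))
      (fun x => ⟨dilatation * (e x).re, (e x).im / dilatation⟩)

/-- The set `Ψ_P` (on the marked surface `(S, M)`) of small dilatation pseudo-Anosov
homeomorphisms: `χ(S) < 0` and `λ(φ) ≤ P ^ (1 / |χ(S)|)`. -/
def Psi (P : ℝ) (S : Type u) [TopologicalSpace S] (M : Finset S) : Set (PseudoAnosov S M) :=
  {f | eulerChar S M < 0 ∧ f.dilatation ≤ P ^ (1 / |(eulerChar S M : ℝ)|)}

/-! ### Rectangles and Markov partitions -/

variable {S : Type u} [TopologicalSpace S] {M : Finset S}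

/-- The closed unit square. -/
def square : Set (ℝ × ℝ) := Icc 0 1 ×ˢ Icc 0 1

/-- The open unit square. -/
def openSquare : Set (ℝ × ℝ) := Ioo 0 1 ×ˢ Ioo 0 1

/-- A rectangle for `q`: a map `ρ` of the unit square to `S` (its values elsewhere are
irrelevant), injective on the interior with open image avoiding the singularities, and in
preferred coordinates locally of the form `(x, y) ↦ ±(a x, b y) + const` with constants
`a, b ≠ 0`. Thus horizontal (vertical) segments go to arcs of horizontal (vertical) leaves,
which only on the boundary may run into singularities. -/
structure Rectangle (q : FlatConeStructure S M) where
  /-- The parametrization. -/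
  ρ : ℝ × ℝ → S
  continuousOn : ContinuousOn ρ square
  injOn : InjOn ρ openSquare
  isOpen_image : IsOpen (ρ '' openSquare)
  interior_regular : ∀ w ∈ openSquare, ρ w ∉ q.sing
  affine : ∃ a b : ℝ, a ≠ 0 ∧ b ≠ 0 ∧ ∀ w ∈ square, ∀ e ∈ q.charts, ρ w ∈ e.source →
    EqUpToSignAndTranslation (𝓝[square] w) (fun z => e (ρ z)) (fun z => ⟨a * z.1, b * z.2⟩)

namespace Rectangle

variable {q : FlatConeStructure S M} (R : Rectangle q)

/-- The rectangle as a subset of `S`. -/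
def carrier : Set S := R.ρ '' square

/-- The interior of the rectangle: the image of the open square. -/
def int : Set S := R.ρ '' openSquare

/-- The vertical boundary. -/
def vertBdry : Set S := R.ρ '' (({0, 1} : Set ℝ) ×ˢ Icc (0 : ℝ) 1)

/-- The horizontal boundary. -/
def horBdry : Set S := R.ρ '' (Icc (0 : ℝ) 1 ×ˢ ({0, 1} : Set ℝ))

end Rectangle

/-- A Markov partition for a pseudo-Anosov homeomorphism. -/
structure MarkovPartition (f : PseudoAnosov S M) where
  /-- The number of rectangles. -/
  n : ℕ
  /-- The rectangles. -/
  rect : Fin n → Rectangle f.q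
  disjoint_int : ∀ i j, i ≠ j → Disjoint (rect i).int (rect j).int
  covers : ⋃ i, (rect i).carrier = univ
  map_vert : f.φ '' (⋃ i, (rect i).vertBdry) ⊆ ⋃ i, (rect i).vertBdry
  map_hor : f.φ.symm '' (⋃ i, (rect i).horBdry) ⊆ ⋃ i, (rect i).horBdry
  marked : ∀ p ∈ M, ∃ i, p ∈ (rect i).vertBdry ∪ (rect i).horBdry

namespace MarkovPartition

variable {f : PseudoAnosov S M} (𝓡 : MarkovPartition f)

/-- A Markov partition is small if it has at most `9 |χ(S)|` rectangles. -/
def IsSmall : Prop := (𝓡.n : ℤ) ≤ 9 * |eulerChar S M|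

/-- The `i`-th rectangle is unmixed by `φ` if `φ` maps it homeomorphically onto a rectangle of
the partition (and its interior onto the interior, as rectangles may be glued to themselves
along their boundary). -/
def Unmixed (i : Fin 𝓡.n) : Prop :=
  ∃ j, f.φ '' (𝓡.rect i).carrier = (𝓡.rect j).carrier ∧
    f.φ '' (𝓡.rect i).int = (𝓡.rect j).int

/-- The `j`-th rectangle is a target of the `i`-th one. -/
def IsTarget (i j : Fin 𝓡.n) : Prop :=
  (f.φ ⁻¹' (𝓡.rect j).int ∩ (𝓡.rect i).carrier).Nonempty

/-- The number of connected components of `φ⁻¹(⋃ int R') ∩ X`, in `ℕ∞`. -/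
def degreeOn (X : Set S) : ℕ∞ :=
  ENat.card (ConnectedComponents ↥(f.φ ⁻¹' (⋃ j, (𝓡.rect j).int) ∩ X))

/-- The degree of a rectangle. -/
def degree (i : Fin 𝓡.n) : ℕ∞ := 𝓡.degreeOn (𝓡.rect i).carrier

/-- The degree of a rectangle, with components counted in its interior. It is at least
`degree`, and differs from it when components meeting along the boundary of a rectangle
that is glued to itself merge into one. -/
def interiorDegree (i : Fin 𝓡.n) : ℕ∞ := 𝓡.degreeOn (𝓡.rect i).int

open Classical in
/-- The codegree of the `i`-th rectangle with respect to a degree function: the sum of the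
degrees of all rectangles having it as a target. -/
def codegree (deg : Fin 𝓡.n → ℕ∞) (i : Fin 𝓡.n) : ℕ∞ :=
  ∑ j with 𝓡.IsTarget j i, deg j

open Classical in
/-- The mixed rectangles. -/
def mixed : Finset (Fin 𝓡.n) := Finset.univ.filter fun i => ¬ 𝓡.Unmixed i

open Classical in
/-- The targets of mixed rectangles. -/
def mixedTargets : Finset (Fin 𝓡.n) :=
  Finset.univ.filter fun j => ∃ i ∈ 𝓡.mixed, 𝓡.IsTarget i j

end MarkovPartition

end

end SmallDilatation

/-!
Let `λ` be the dilatation. In each rectangle `R` of a Markov partition, the preimages of the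
interiors of the rectangles form finitely many vertical strips, each of which `φ` maps onto a
subrectangle of some `R'` extending over the whole width of `R'` (`exists_isStrip`): the affine
formula for `φ` near a point persists along such a strip, since horizontal sides are not met and
vertical sides are mapped to vertical sides. Let `A R R'` be the number of strips of `R` mapped
into `R'` (`transition`). Comparing widths and heights, the widths form a positive right
eigenvector of `A` for `λ` (`transition_mul_width`) and the heights a positive left sub-eigenvector
(`sum_transition_mul_height_le`), hence even a left eigenvector (`sum_mul_eq_of_le`).

For such a matrix of size `n` the excess `∑ (outdegree - 1)` is at most `λ ^ n - 1`
(`sum_excess_le`), whether or not it is irreducible. If `v` has the least width, there are at most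
`λ ^ k` paths of length `k` from `v`; on the other hand, their number is
`1 + ∑ (outdegree - 1)`, the sum being over all visits of these paths to vertices before time `k`
(`sum_pow_apply`), and every vertex that can be reached from `v` at all is visited before the time
`k` equal to the number of these vertices. This gives the bound for the set of vertices reachable
from `v`. By conservation of area no transition enters this set (`mem_of_transition_mem`), so its
complement can be treated separately, and the bounds combine by `(x - 1) + (y - 1) ≤ x y - 1`.

For a small partition, `λ ≤ P ^ (1 / |χ|)` gives `λ ^ n ≤ P ^ 9`, so the excess of the
outdegrees is bounded by a constant, and so is that of the indegrees, since both degrees have the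
same sum. A rectangle with one strip whose target receives one strip is unmixed
(`unmixed_of_transition_pos`), and degrees are at most outdegrees; the rest is counting
(`card_and_sums_le`).
-/

namespace SmallDilatation

variable {S : Type u} [TopologicalSpace S] {M : Finset S}

/-! ### Rectangles in preferred coordinates -/

namespace Rectangle

variable {q : FlatConeStructure S M} (R : Rectangle q)

/-- The horizontal scale factor of the parametrization; its sign depends on a choice. -/
noncomputable def scaleX : ℝ := R.affine.choose

/-- The vertical scale factor of the parametrization; its sign depends on a choice. -/
noncomputable def scaleY : ℝ := R.affine.choose_spec.choose

lemma scaleX_ne : R.scaleX ≠ 0 := R.affine.choose_spec.choose_spec.1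

lemma scaleY_ne : R.scaleY ≠ 0 := R.affine.choose_spec.choose_spec.2.1

lemma affine_scale {w : ℝ × ℝ} (hw : w ∈ square) {e : OpenPartialHomeomorph S ℂ}
    (he : e ∈ q.charts) (hwe : R.ρ w ∈ e.source) :
    EqUpToSignAndTranslation (𝓝[square] w) (fun z => e (R.ρ z))
      (fun z => ⟨R.scaleX * z.1, R.scaleY * z.2⟩) :=
  R.affine.choose_spec.choose_spec.2.2 w hw e he hwe

end Rectangle

lemma isOpen_openSquare : IsOpen openSquare := isOpen_Ioo.prod isOpen_Ioo

lemma openSquare_subset_square : openSquare ⊆ square :=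
  prod_mono Ioo_subset_Icc_self Ioo_subset_Icc_self

lemma square_subset_closure_openSquare : square ⊆ closure openSquare := by
  rw [openSquare, closure_prod_eq, closure_Ioo zero_ne_one]
  exact subset_rfl

lemma nhdsWithin_square {w : ℝ × ℝ} (hw : w ∈ openSquare) : 𝓝[square] w = 𝓝 w :=
  nhdsWithin_eq_nhds.2 (mem_of_superset (isOpen_openSquare.mem_nhds hw) openSquare_subset_square)

/-- A map that is affine in preferred coordinates is affine in the parameters of rectangles: where
it sends a point of `R` to an interior point of `R'`, it is locally
`(x, y) ↦ ±(α x, β y) + const`, with `α` and `β` determined by the rectangles. -/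
lemma Rectangle.eventually_eq_affine {q : FlatConeStructure S M} (R R' : Rectangle q)
    {g : S → S} (hg : Continuous g) {μ : ℝ} (hμ : μ ≠ 0)
    (hsing : ∀ p, g p ∉ q.sing → p ∉ q.sing)
    (haff : ∀ e ∈ q.charts, ∀ e' ∈ q.charts, ∀ p ∈ e.source, g p ∈ e'.source →
      EqUpToSignAndTranslation (𝓝 p) (fun x => e' (g x)) (fun x => ⟨μ * (e x).re, (e x).im / μ⟩))
    {w u : ℝ × ℝ} (hw : w ∈ square) (hu : u ∈ openSquare) (h : g (R.ρ w) = R'.ρ u) :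
    ∃ σ : ℝ, (σ = 1 ∨ σ = -1) ∧ ∀ᶠ z in 𝓝[square] w,
      g (R.ρ z) = R'.ρ (u.1 + σ * (μ * R.scaleX / R'.scaleX) * (z.1 - w.1),
        u.2 + σ * (R.scaleY / (μ * R'.scaleY)) * (z.2 - w.2)) := by
  have hreg : R'.ρ u ∉ q.sing := R'.interior_regular u hu
  obtain ⟨e', he', hue'⟩ := q.covers _ hreg
  obtain ⟨e, he, hwe⟩ := q.covers (R.ρ w) (hsing _ (h ▸ hreg))
  obtain ⟨ε₁, c₁, hε₁, h₁⟩ := R.affine_scale hw he hwe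
  obtain ⟨ε₂, c₂, hε₂, h₂⟩ := haff e he e' he' _ hwe (h ▸ hue')
  obtain ⟨ε₃, c₃, hε₃, h₃⟩ := R'.affine_scale (openSquare_subset_square hu) he' hue'
  rw [nhdsWithin_square hu] at h₃
  have hρ : Tendsto R.ρ (𝓝[square] w) (𝓝 (R.ρ w)) := R.continuousOn w hw
  have hρ' : Tendsto R'.ρ (𝓝 u) (𝓝 (R'.ρ u)) := by
    have := R'.continuousOn u (openSquare_subset_square hu)
    rwa [ContinuousWithinAt, nhdsWithin_square hu] at this
  have h₂' := hρ.eventually h₂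
  have ha := R.scaleX_ne
  have hb := R.scaleY_ne
  have ha' := R'.scaleX_ne
  have hb' := R'.scaleY_ne
  have key : ∀ σ : ℝ, (ε₁ * ε₂ * ε₃ = σ) → ∀ᶠ z in 𝓝[square] w,
      g (R.ρ z) = R'.ρ (u.1 + σ * (μ * R.scaleX / R'.scaleX) * (z.1 - w.1),
        u.2 + σ * (R.scaleY / (μ * R'.scaleY)) * (z.2 - w.2)) := by
    intro σ hσ
    have ht : Tendsto (fun z : ℝ × ℝ => (u.1 + σ * (μ * R.scaleX / R'.scaleX) * (z.1 - w.1),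
        u.2 + σ * (R.scaleY / (μ * R'.scaleY)) * (z.2 - w.2))) (𝓝[square] w) (𝓝 u) := by
      have : Continuous (fun z : ℝ × ℝ => (u.1 + σ * (μ * R.scaleX / R'.scaleX) * (z.1 - w.1),
        u.2 + σ * (R.scaleY / (μ * R'.scaleY)) * (z.2 - w.2))) := by fun_prop
      have h0 := (this.tendsto w).mono_left (nhdsWithin_le_nhds (s := square))
      simpa using h0
    have m₁ := (hg.continuousAt.tendsto.comp hρ).eventually
      (e'.open_source.mem_nhds (show g (R.ρ w) ∈ e'.source from h ▸ hue'))
    have m₂ := (hρ'.comp ht).eventually (e'.open_source.mem_nhds hue')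
    filter_upwards [h₁, h₂', ht.eventually h₃, m₁, m₂] with z z₁ z₂ z₃ n₁ n₂
    refine e'.injOn n₁ n₂ ?_
    have w₁ := h₁.self_of_nhdsWithin hw
    have w₂ := h₂.self_of_nhds
    have w₃ := h₃.self_of_nhds
    simp only at z₁ z₂ z₃ w₁ w₂ w₃
    rw [h, w₃] at w₂
    show e' (g (R.ρ z)) = e' (R'.ρ _)
    rw [z₂, z₃]
    rw [z₁]
    rw [w₁] at w₂
    have hre := congrArg Complex.re w₂
    have him := congrArg Complex.im w₂
    rcases hε₁ with rfl | rfl <;> rcases hε₂ with rfl | rfl <;> rcases hε₃ with rfl | rfl <;>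
    · simp at hre him hσ
      norm_cast at hσ
      subst hσ
      apply Complex.ext
      · simp
        field_simp at hre ⊢
        linarith
      · simp
        field_simp at him ⊢
        linarith
  rcases hε₁ with rfl | rfl <;> rcases hε₂ with rfl | rfl <;> rcases hε₃ with rfl | rfl
  · exact ⟨1, .inl rfl, key 1 (by norm_num)⟩
  · exact ⟨-1, .inr rfl, key (-1) (by norm_num)⟩
  · exact ⟨-1, .inr rfl, key (-1) (by norm_num)⟩
  · exact ⟨1, .inl rfl, key 1 (by norm_num)⟩
  · exact ⟨-1, .inr rfl, key (-1) (by norm_num)⟩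
  · exact ⟨1, .inl rfl, key 1 (by norm_num)⟩
  · exact ⟨1, .inl rfl, key 1 (by norm_num)⟩
  · exact ⟨-1, .inr rfl, key (-1) (by norm_num)⟩

/-- The parametrization of a rectangle takes no boundary point to an interior point. -/
lemma Rectangle.mem_openSquare_of_eq {q : FlatConeStructure S M} (R : Rectangle q)
    {w z : ℝ × ℝ} (hw : w ∈ openSquare) (hz : z ∈ square) (h : R.ρ z = R.ρ w) :
    z ∈ openSquare := by
  by_contra hzo
  have hne : z ≠ w := fun H => hzo (H ▸ hw)
  obtain ⟨σ, -, hev⟩ := R.eventually_eq_affine R (g := id) continuous_id (μ := 1) one_ne_zero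
    (fun p hp => hp) (fun e he e' he' p hp hp' => by
      obtain ⟨ε, c, hε, H⟩ := q.compatible e he e' he' p ⟨hp, hp'⟩
      exact ⟨ε, c, hε, by simpa using H⟩) hz hw h
  -- Points near `z` have the same image as points `t y` near `w`; for interior `y` this
  -- contradicts injectivity.
  set t : ℝ × ℝ → ℝ × ℝ := fun y => (w.1 + σ * (1 * R.scaleX / R.scaleX) * (y.1 - z.1),
        w.2 + σ * (R.scaleY / (1 * R.scaleY)) * (y.2 - z.2)) with ht
  have htc : Continuous t := by fun_prop
  have htz : t z = w := by simp [t]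
  have m₁ : ∀ᶠ y in 𝓝[square] z, t y ∈ openSquare :=
    ((htc.tendsto z).mono_left nhdsWithin_le_nhds).eventually
      (isOpen_openSquare.mem_nhds (by rwa [htz]))
  have m₂ : ∀ᶠ y in 𝓝[square] z, t y ≠ y := by
    have : Tendsto (fun y => (t y, y)) (𝓝[square] z) (𝓝 (w, z)) := by
      have h0 := ((htc.prodMk continuous_id).tendsto z).mono_left (nhdsWithin_le_nhds (s := square))
      simpa [htz] using h0
    have ho : IsOpen {p : (ℝ × ℝ) × (ℝ × ℝ) | p.1 ≠ p.2} :=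
      isOpen_ne_fun continuous_fst continuous_snd
    exact this.eventually (ho.mem_nhds hne.symm)
  have hfr : ∃ᶠ y in 𝓝[square] z, y ∈ openSquare := by
    rw [frequently_nhdsWithin_iff]
    exact (mem_closure_iff_frequently.1 (square_subset_closure_openSquare hz)).mono
      fun y hy => ⟨hy, openSquare_subset_square hy⟩
  obtain ⟨y, hyo, hy₁, hy₂, hy⟩ := (hfr.and_eventually (m₁.and (m₂.and hev))).exists
  exact hy₂ (R.injOn hy₁ hyo hy.symm)

/-! ### Strips -/

lemma exists_Ioo_preimage_affine {m : ℝ} (hm : m ≠ 0) (c : ℝ) :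
    ∃ l r : ℝ, l < r ∧ ((m * l + c = 0 ∧ m * r + c = 1) ∨ (m * l + c = 1 ∧ m * r + c = 0)) ∧
      ∀ x, m * x + c ∈ Ioo 0 1 ↔ x ∈ Ioo l r := by
  have h0 : m * (-c / m) + c = 0 := by field_simp; ring
  have h1 : m * ((1 - c) / m) + c = 1 := by field_simp; ring
  rcases hm.lt_or_gt with hm | hm
  · refine ⟨(1 - c) / m, -c / m, by by_contra! H; nlinarith, .inr ⟨h1, h0⟩, fun x => ?_⟩
    constructor
    · rintro ⟨h, h'⟩
      constructor <;> by_contra! H <;> nlinarith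
    · rintro ⟨h, h'⟩
      constructor <;> nlinarith
  · refine ⟨-c / m, (1 - c) / m, by by_contra! H; nlinarith, .inl ⟨h0, h1⟩, fun x => ?_⟩
    constructor
    · rintro ⟨h, h'⟩
      constructor <;> by_contra! H <;> nlinarith
    · rintro ⟨h, h'⟩
      constructor <;> nlinarith

lemma affine_mem_Icc {k d : ℝ} (h : ∀ y ∈ Ioo (0 : ℝ) 1, k * y + d ∈ Ioo 0 1) {y : ℝ}
    (hy : y ∈ Icc (0 : ℝ) 1) : k * y + d ∈ Icc (0 : ℝ) 1 := by
  have hcont : Continuous fun y : ℝ => k * y + d := by fun_prop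
  rw [← closure_Ioo zero_ne_one] at hy ⊢
  exact hcont.closure_preimage_subset (Ioo (0 : ℝ) 1) (closure_mono h hy)

namespace MarkovPartition

variable {f : PseudoAnosov S M} (𝓡 : MarkovPartition f)

/-- The width of the `i`-th rectangle. -/
noncomputable def width (i : Fin 𝓡.n) : ℝ := |(𝓡.rect i).scaleX|

/-- The height of the `i`-th rectangle. -/
noncomputable def height (i : Fin 𝓡.n) : ℝ := |(𝓡.rect i).scaleY|

lemma width_pos (i : Fin 𝓡.n) : 0 < 𝓡.width i := abs_pos.2 (𝓡.rect i).scaleX_ne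

lemma height_pos (i : Fin 𝓡.n) : 0 < 𝓡.height i := abs_pos.2 (𝓡.rect i).scaleY_ne

lemma dilatation_pos : 0 < f.dilatation := one_pos.trans f.one_lt_dilatation

/-- An interior point of a rectangle lies in no other rectangle and has a single parameter. -/
lemma eq_of_ρ_eq {i j : Fin 𝓡.n} {w z : ℝ × ℝ} (hw : w ∈ openSquare) (hz : z ∈ square)
    (h : (𝓡.rect i).ρ w = (𝓡.rect j).ρ z) : i = j ∧ w = z := by
  have hij : i = j := by
    by_contra hne
    have hint : (𝓡.rect i).int ∈ 𝓝 ((𝓡.rect j).ρ z) :=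
      (𝓡.rect i).isOpen_image.mem_nhds (h ▸ mem_image_of_mem _ hw)
    have hev : ∀ᶠ y in 𝓝[square] z, (𝓡.rect j).ρ y ∈ (𝓡.rect i).int :=
      ((𝓡.rect j).continuousOn z hz).eventually hint
    have hfr : ∃ᶠ y in 𝓝[square] z, y ∈ openSquare := by
      rw [frequently_nhdsWithin_iff]
      exact (mem_closure_iff_frequently.1 (square_subset_closure_openSquare hz)).mono
        fun y hy => ⟨hy, openSquare_subset_square hy⟩
    obtain ⟨y, hy, hy'⟩ := (hfr.and_eventually hev).exists
    exact disjoint_left.1 (𝓡.disjoint_int i j hne) hy' (mem_image_of_mem _ hy)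
  subst hij
  exact ⟨rfl, (𝓡.rect i).injOn hw ((𝓡.rect i).mem_openSquare_of_eq hw hz h.symm) h⟩

lemma not_mem_int {i j : Fin 𝓡.n} {z : ℝ × ℝ} (hz : z ∈ square) (hz' : z ∉ openSquare) :
    (𝓡.rect j).ρ z ∉ (𝓡.rect i).int := by
  rintro ⟨w, hw, h⟩
  exact hz' ((𝓡.eq_of_ρ_eq hw hz h).2 ▸ hw)

/-- The vertical sides are mapped to vertical sides, hence not into the interior of a rectangle. -/
lemma φ_vert_not_mem_int {i j : Fin 𝓡.n} {x y : ℝ} (hx : x = 0 ∨ x = 1) (hy : y ∈ Icc (0 : ℝ) 1) :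
    f.φ ((𝓡.rect i).ρ (x, y)) ∉ (𝓡.rect j).int := by
  have h := 𝓡.map_vert (mem_image_of_mem f.φ (mem_iUnion.2 ⟨i, mem_image_of_mem _
    (show (x, y) ∈ ({0, 1} : Set ℝ) ×ˢ Icc (0 : ℝ) 1 from ⟨by simpa using hx, hy⟩)⟩))
  obtain ⟨k, z, hz, hzk⟩ := mem_iUnion.1 h
  rw [← hzk]
  have h01 : z.1 = 0 ∨ z.1 = 1 := by simpa using hz.1
  refine 𝓡.not_mem_int ⟨?_, hz.2⟩ fun H => ?_
  · rcases h01 with h | h <;> simp [h]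
  · have := H.1
    rcases h01 with h | h <;> simp [h] at this

/-- No interior point of a rectangle is mapped to a horizontal side. -/
lemma φ_ne_hor {i j : Fin 𝓡.n} {w : ℝ × ℝ} (hw : w ∈ openSquare) {x y : ℝ}
    (hx : x ∈ Icc (0 : ℝ) 1) (hy : y = 0 ∨ y = 1) :
    f.φ ((𝓡.rect i).ρ w) ≠ (𝓡.rect j).ρ (x, y) := by
  intro H
  have h := 𝓡.map_hor (mem_image_of_mem f.φ.symm (mem_iUnion.2 ⟨j, mem_image_of_mem _
    (show (x, y) ∈ Icc (0 : ℝ) 1 ×ˢ ({0, 1} : Set ℝ) from ⟨hx, by simpa using hy⟩)⟩))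
  rw [← H, f.φ.symm_apply_apply] at h
  obtain ⟨k, z, hz, hzk⟩ := mem_iUnion.1 h
  have h01 : z.2 = 0 ∨ z.2 = 1 := by simpa using hz.2
  refine 𝓡.not_mem_int (i := i) (j := k) (z := z) ⟨hz.1, ?_⟩ (fun H => ?_)
    (hzk ▸ mem_image_of_mem _ hw)
  · rcases h01 with h | h <;> simp [h]
  · have := H.2
    rcases h01 with h | h <;> simp [h] at this

/-- The part `[l, r] × [0, 1]` of the `i`-th rectangle is a strip that `φ` maps affinely onto a
subrectangle of the `j`-th rectangle extending over the whole width of the latter. The map in the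
parameters is `(x, y) ↦ (m x + c, k y + d)`, with `|m|` and `|k|` determined by the dimensions of
the rectangles. -/
def IsStrip (i j : Fin 𝓡.n) (l r : ℝ) : Prop :=
  0 ≤ l ∧ l < r ∧ r ≤ 1 ∧ ∃ m c k d : ℝ,
    |m| = f.dilatation * 𝓡.width i / 𝓡.width j ∧
    |k| = 𝓡.height i / (f.dilatation * 𝓡.height j) ∧
    ((m * l + c = 0 ∧ m * r + c = 1) ∨ (m * l + c = 1 ∧ m * r + c = 0)) ∧
    (∀ x, m * x + c ∈ Ioo 0 1 ↔ x ∈ Ioo l r) ∧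
    (∀ y ∈ Ioo (0 : ℝ) 1, k * y + d ∈ Ioo 0 1) ∧
    ∀ z ∈ Icc l r ×ˢ Icc 0 1,
      f.φ ((𝓡.rect i).ρ z) = (𝓡.rect j).ρ (m * z.1 + c, k * z.2 + d)

/-- A formula for `φ` in the parameters of two rectangles extends to the closure. -/
lemma eq_of_mem_closure [T2Space S] {i j : Fin 𝓡.n} {D : Set (ℝ × ℝ)} {h : ℝ × ℝ → ℝ × ℝ}
    (hh : Continuous h) (hD : D ⊆ square)
    (H : ∀ z ∈ D, f.φ ((𝓡.rect i).ρ z) = (𝓡.rect j).ρ (h z) ∧ h z ∈ square)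
    {z : ℝ × ℝ} (hz : z ∈ closure D) :
    f.φ ((𝓡.rect i).ρ z) = (𝓡.rect j).ρ (h z) ∧ h z ∈ square := by
  have hsq : IsClosed square := isClosed_Icc.prod isClosed_Icc
  have hzs : z ∈ square := closure_minimal hD hsq hz
  have hne : (𝓝[D] z).NeBot := mem_closure_iff_nhdsWithin_neBot.1 hz
  have ht : Tendsto h (𝓝[D] z) (𝓝 (h z)) := (hh.tendsto z).mono_left nhdsWithin_le_nhds
  have hmem : ∀ᶠ y in 𝓝[D] z, h y ∈ square :=
    eventually_nhdsWithin_of_forall fun y hy => (H y hy).2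
  have hhz : h z ∈ square := hsq.mem_of_tendsto ht hmem
  refine ⟨?_, hhz⟩
  have t₁ : Tendsto (fun y => f.φ ((𝓡.rect i).ρ y)) (𝓝[D] z) (𝓝 (f.φ ((𝓡.rect i).ρ z))) :=
    (f.φ.continuous.tendsto _).comp
      (((𝓡.rect i).continuousOn z hzs).mono_left (nhdsWithin_mono z hD))
  have t₂ : Tendsto (fun y => (𝓡.rect j).ρ (h y)) (𝓝[D] z) (𝓝 ((𝓡.rect j).ρ (h z))) :=
    ((𝓡.rect j).continuousOn (h z) hhz).tendsto.comp
      (tendsto_nhdsWithin_iff.2 ⟨ht, hmem⟩)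
  exact tendsto_nhds_unique_of_eventuallyEq t₁ t₂
    (eventually_nhdsWithin_of_forall fun y hy => (H y hy).1)

lemma eventually_eq_affine {i j : Fin 𝓡.n} {w u : ℝ × ℝ} (hw : w ∈ openSquare)
    (hu : u ∈ openSquare) (h : f.φ ((𝓡.rect i).ρ w) = (𝓡.rect j).ρ u) :
    ∃ σ : ℝ, (σ = 1 ∨ σ = -1) ∧ ∀ᶠ z in 𝓝 w,
      f.φ ((𝓡.rect i).ρ z) = (𝓡.rect j).ρ
        (u.1 + σ * (f.dilatation * (𝓡.rect i).scaleX / (𝓡.rect j).scaleX) * (z.1 - w.1),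
        u.2 + σ * ((𝓡.rect i).scaleY / (f.dilatation * (𝓡.rect j).scaleY)) * (z.2 - w.2)) := by
  rw [← nhdsWithin_square hw]
  exact (𝓡.rect i).eventually_eq_affine (𝓡.rect j) f.φ.continuous dilatation_pos.ne'
    (fun p => mt (f.map_sing p).2) f.affine (openSquare_subset_square hw) hu h

/-- Every interior point of a rectangle that `φ` maps to an interior point of a rectangle lies in
a strip. The affine formula holding near the point persists along the strip, as the image never
meets a horizontal side, and the strip ends inside the rectangle, as the vertical sides do not map
into the interior of rectangles. -/
lemma exists_isStrip [T2Space S] {i j : Fin 𝓡.n} {w : ℝ × ℝ} (hw : w ∈ openSquare)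
    (h : f.φ ((𝓡.rect i).ρ w) ∈ (𝓡.rect j).int) :
    ∃ l r, 𝓡.IsStrip i j l r ∧ w.1 ∈ Ioo l r := by
  obtain ⟨u, hu, hwu⟩ := h
  obtain ⟨σ, hσ, hev⟩ := 𝓡.eventually_eq_affine hw hu hwu.symm
  set α := f.dilatation * (𝓡.rect i).scaleX / (𝓡.rect j).scaleX with hα
  set β := (𝓡.rect i).scaleY / (f.dilatation * (𝓡.rect j).scaleY) with hβ
  have hα0 : α ≠ 0 :=
    div_ne_zero (mul_ne_zero dilatation_pos.ne' (𝓡.rect i).scaleX_ne) (𝓡.rect j).scaleX_ne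
  have hσ0 : σ ≠ 0 := by rcases hσ with rfl | rfl <;> norm_num
  have hσ1 : |σ| = 1 := by rcases hσ with rfl | rfl <;> norm_num
  obtain ⟨m, hm⟩ : ∃ m, m = σ * α := ⟨_, rfl⟩
  obtain ⟨k, hk⟩ : ∃ k, k = σ * β := ⟨_, rfl⟩
  obtain ⟨c, hc⟩ : ∃ c, c = u.1 - m * w.1 := ⟨_, rfl⟩
  obtain ⟨d, hd⟩ : ∃ d, d = u.2 - k * w.2 := ⟨_, rfl⟩
  have hm0 : m ≠ 0 := hm ▸ mul_ne_zero hσ0 hα0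
  set a : ℝ × ℝ → ℝ × ℝ := fun z => (m * z.1 + c, k * z.2 + d) with ha
  have hac : Continuous a := by fun_prop
  have haw : a w = u := by simp [a, hc, hd]
  obtain ⟨l, r, hlr, hends, hiff⟩ := exists_Ioo_preimage_affine hm0 c
  have hwlr : w.1 ∈ Ioo l r := (hiff _).1 (by have := congrArg Prod.fst haw; simp only [a] at this
                                              rw [this]; exact hu.1)
  set D : Set (ℝ × ℝ) := Ioo (max 0 l) (min 1 r) ×ˢ Ioo (0 : ℝ) 1 with hD
  have hDsub : D ⊆ openSquare := prod_mono
    (Ioo_subset_Ioo (le_max_left _ _) (min_le_left _ _)) subset_rfl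
  have hDx : ∀ z ∈ D, m * z.1 + c ∈ Ioo 0 1 := fun z hz =>
    (hiff _).2 ⟨(le_max_right _ _).trans_lt hz.1.1, hz.1.2.trans_le (min_le_right _ _)⟩
  have hwD : w ∈ D := ⟨⟨max_lt hw.1.1 hwlr.1, lt_min hw.1.2 hwlr.2⟩, hw.2⟩
  set C : Set (ℝ × ℝ) := {z | ∀ᶠ y in 𝓝 z,
    f.φ ((𝓡.rect i).ρ y) = (𝓡.rect j).ρ (a y) ∧ a y ∈ openSquare} with hC
  have hCo : IsOpen C := isOpen_setOfPred_eventually_nhds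
  have hwC : w ∈ C := by
    have h₁ : ∀ᶠ y in 𝓝 w, a y ∈ openSquare :=
      (hac.tendsto w).eventually (isOpen_openSquare.mem_nhds (haw ▸ hu))
    filter_upwards [hev, h₁] with y hy hy'
    refine ⟨?_, hy'⟩
    rw [hy]
    congr 1
    ext <;> simp only [a, hc, hd, hm, hk] <;> ring
  -- The formula persists on `D`: the points where it holds nearby are relatively closed in `D`.
  have hDC : D ⊆ C := by
    have hpre : IsPreconnected D := ((convex_Ioo _ _).prod (convex_Ioo _ _)).isPreconnected
    refine hpre.subset_of_closure_inter_subset hCo ⟨w, hwD, hwC⟩ ?_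
    rintro z ⟨hzC, hzD⟩
    have hzo := hDsub hzD
    have hz' : z ∈ closure (C ∩ openSquare) := by
      rw [inter_comm]
      exact isOpen_openSquare.inter_closure ⟨hzo, hzC⟩
    obtain ⟨hzeq, hzsq⟩ := 𝓡.eq_of_mem_closure hac
      (inter_subset_right.trans openSquare_subset_square)
      (fun y hy => ⟨hy.1.self_of_nhds.1, openSquare_subset_square hy.1.self_of_nhds.2⟩) hz'
    have hao : a z ∈ openSquare := by
      refine ⟨hDx z hzD, hzsq.2.1.lt_of_ne fun H => ?_, hzsq.2.2.lt_of_ne fun H => ?_⟩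
      · exact 𝓡.φ_ne_hor hzo hzsq.1 (.inl H.symm) hzeq
      · exact 𝓡.φ_ne_hor hzo hzsq.1 (.inr H) hzeq
    obtain ⟨τ, hτ, hτev⟩ := 𝓡.eventually_eq_affine hzo hao hzeq
    rw [← hα, ← hβ] at hτev
    set b : ℝ × ℝ → ℝ × ℝ := fun y =>
      ((a z).1 + τ * α * (y.1 - z.1), (a z).2 + τ * β * (y.2 - z.2)) with hb
    have hbc : Continuous b := by fun_prop
    have hbo : ∀ᶠ y in 𝓝 z, b y ∈ openSquare :=
      (hbc.tendsto z).eventually (isOpen_openSquare.mem_nhds (by simpa [b] using hao))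
    -- The two affine formulas agree near a point of `C` close to `z`, so their signs agree.
    have hστ : σ = τ := by
      obtain ⟨y, hyC, hy⟩ := ((mem_closure_iff_frequently.1 hzC).and_eventually
        (hτev.and hbo).eventually_nhds).exists
      have hab : ∀ᶠ v in 𝓝 y, (σ - τ) * α * (v.1 - z.1) = 0 := by
        filter_upwards [hyC, hy] with v hv hv'
        have := (𝓡.rect j).injOn hv.2 hv'.2 (hv.1.symm.trans hv'.1)
        have := congrArg Prod.fst this
        simp only [a, b, hm] at this
        linarith
      have hline : Tendsto (fun t : ℝ => (y.1 + t, y.2)) (𝓝[≠] 0) (𝓝 y) := by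
        have hcont : Continuous (fun t : ℝ => (y.1 + t, y.2)) := by fun_prop
        have := (hcont.tendsto 0).mono_left (nhdsWithin_le_nhds (s := {0}ᶜ))
        simpa using this
      by_contra hne
      have hy0 := hab.self_of_nhds
      obtain ⟨t, ht, ht'⟩ := ((hline.eventually hab).and self_mem_nhdsWithin).exists
      have h0 : (σ - τ) * α * t = 0 := by simp only at ht; linarith
      exact mul_ne_zero (mul_ne_zero (sub_ne_zero.2 hne) hα0) ht' h0
    show ∀ᶠ y in 𝓝 z, _
    filter_upwards [hτev, hbo] with y hy hy'
    have hya : a y = b y := by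
      ext <;> simp only [a, b, ← hστ, hm, hk] <;> ring
    exact ⟨by rw [hya]; exact hy, by rw [hya]; exact hy'⟩
  have hcl : closure D = Icc (max 0 l) (min 1 r) ×ˢ Icc (0 : ℝ) 1 := by
    rw [hD, closure_prod_eq, closure_Ioo (hwD.1.1.trans hwD.1.2).ne, closure_Ioo zero_ne_one]
  have hext : ∀ z ∈ Icc (max 0 l) (min 1 r) ×ˢ Icc (0 : ℝ) 1,
      f.φ ((𝓡.rect i).ρ z) = (𝓡.rect j).ρ (a z) ∧ a z ∈ square := by
    intro z hz
    refine 𝓡.eq_of_mem_closure hac (hDsub.trans openSquare_subset_square) (fun y hy => ?_)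
      (hcl ▸ hz)
    have := (hDC hy).self_of_nhds
    exact ⟨this.1, openSquare_subset_square this.2⟩
  have haw2 : k * w.2 + d = u.2 := congrArg Prod.snd haw
  have hw2 : w.2 ∈ Icc (0 : ℝ) 1 := Ioo_subset_Icc_self hw.2
  -- If the formula were to map a point of a vertical side of the rectangle to an interior point,
  -- this would contradict the invariance of the vertical sides.
  have hl0 : 0 ≤ l := by
    by_contra! H
    have hz : ((0 : ℝ), w.2) ∈ Icc (max 0 l) (min 1 r) ×ˢ Icc (0 : ℝ) 1 :=
      ⟨⟨by simp [H.le], (hw.1.1.trans (lt_min hw.1.2 hwlr.2)).le⟩, hw2⟩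
    refine 𝓡.φ_vert_not_mem_int (i := i) (j := j) (.inl rfl) hw2 ⟨_, ⟨?_, ?_⟩, (hext _ hz).1.symm⟩
    · exact (hiff _).2 ⟨H, hw.1.1.trans hwlr.2⟩
    · show k * w.2 + d ∈ _
      rw [haw2]; exact hu.2
  have hr1 : r ≤ 1 := by
    by_contra! H
    have hz : ((1 : ℝ), w.2) ∈ Icc (max 0 l) (min 1 r) ×ˢ Icc (0 : ℝ) 1 :=
      ⟨⟨((max_lt hw.1.1 hwlr.1).trans hw.1.2).le, by simp [H.le]⟩, hw2⟩
    refine 𝓡.φ_vert_not_mem_int (i := i) (j := j) (.inr rfl) hw2 ⟨_, ⟨?_, ?_⟩, (hext _ hz).1.symm⟩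
    · exact (hiff _).2 ⟨hwlr.1.trans hw.1.2, H⟩
    · show k * w.2 + d ∈ _
      rw [haw2]; exact hu.2
  rw [max_eq_right hl0, min_eq_right hr1] at hext
  have hlam : |f.dilatation| = f.dilatation := abs_of_pos dilatation_pos
  refine ⟨l, r, ⟨hl0, hlr, hr1, m, c, k, d, ?_, ?_, hends, hiff, fun y hy => ?_,
    fun z hz => (hext z hz).1⟩, hwlr⟩
  · simp only [hm, hα, abs_mul, abs_div, hσ1, hlam, one_mul, width]
  · simp only [hk, hβ, abs_mul, abs_div, hσ1, hlam, one_mul, height]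
  · exact (hDC (show (w.1, y) ∈ D from ⟨hwD.1, hy⟩)).self_of_nhds.2.2

variable {𝓡} {i j i' j' : Fin 𝓡.n} {l r l' r' : ℝ}

lemma IsStrip.φ_mem_int (h : 𝓡.IsStrip i j l r) {z : ℝ × ℝ} (hz : z.1 ∈ Ioo l r)
    (hz' : z.2 ∈ Ioo (0 : ℝ) 1) : f.φ ((𝓡.rect i).ρ z) ∈ (𝓡.rect j).int := by
  obtain ⟨-, -, -, m, c, k, d, -, -, -, hiff, hy, heq⟩ := h
  rw [heq z ⟨Ioo_subset_Icc_self hz, Ioo_subset_Icc_self hz'⟩]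
  exact mem_image_of_mem _ ⟨(hiff _).2 hz, hy _ hz'⟩

lemma IsStrip.φ_end_not_mem_int (h : 𝓡.IsStrip i j l r) {x y : ℝ} (hx : x = l ∨ x = r)
    (hyy : y ∈ Ioo (0 : ℝ) 1) : f.φ ((𝓡.rect i).ρ (x, y)) ∉ (𝓡.rect j').int := by
  obtain ⟨-, hlr, -, m, c, k, d, -, -, hends, hiff, hy, heq⟩ := h
  rw [heq (x, y) ⟨by rcases hx with rfl | rfl <;> simp [hlr.le], Ioo_subset_Icc_self hyy⟩]
  have h01 : m * x + c = 0 ∨ m * x + c = 1 := by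
    rcases hends with h | h <;> rcases hx with rfl | rfl <;> simp [h]
  refine 𝓡.not_mem_int ⟨?_, Ioo_subset_Icc_self (hy _ hyy)⟩ fun H => ?_
  · rcases h01 with h | h <;> simp [h]
  · have := H.1
    rcases h01 with h | h <;> simp [h] at this

lemma IsStrip.length (h : 𝓡.IsStrip i j l r) :
    f.dilatation * 𝓡.width i * (r - l) = 𝓡.width j := by
  obtain ⟨-, hlr, -, m, c, k, d, hm, -, hends, -, -, -⟩ := h
  have hj := 𝓡.width_pos j
  have : |m| * (r - l) = 1 := by
    rw [← abs_of_pos (sub_pos.2 hlr), ← abs_mul]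
    rcases hends with h | h
    · rw [show m * (r - l) = 1 by linarith, abs_one]
    · rw [show m * (r - l) = -1 by linarith, abs_neg, abs_one]
  rw [hm] at this
  field_simp at this
  linarith

/-- Distinct strips of a rectangle do not overlap. -/
lemma IsStrip.eq_of_mem (h : 𝓡.IsStrip i j l r) (h' : 𝓡.IsStrip i j' l' r') {x : ℝ}
    (hx : x ∈ Ioo l r) (hx' : x ∈ Ioo l' r') : j = j' ∧ l = l' ∧ r = r' := by
  have half : (1 / 2 : ℝ) ∈ Ioo (0 : ℝ) 1 := by norm_num
  refine ⟨?_, ?_, ?_⟩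
  · by_contra hne
    exact disjoint_left.1 (𝓡.disjoint_int _ _ hne) (h.φ_mem_int (z := (x, 1 / 2)) hx half)
      (h'.φ_mem_int (z := (x, 1 / 2)) hx' half)
  · rcases lt_trichotomy l l' with H | H | H
    · exact absurd (h.φ_mem_int (z := (l', 1 / 2)) ⟨H, hx'.1.trans hx.2⟩ half)
        (h'.φ_end_not_mem_int (.inl rfl) half)
    · exact H
    · exact absurd (h'.φ_mem_int (z := (l, 1 / 2)) ⟨H, hx.1.trans hx'.2⟩ half)
        (h.φ_end_not_mem_int (.inl rfl) half)
  · rcases lt_trichotomy r r' with H | H | H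
    · exact absurd (h'.φ_mem_int (z := (r, 1 / 2)) ⟨hx'.1.trans hx.2, H⟩ half)
        (h.φ_end_not_mem_int (.inr rfl) half)
    · exact H
    · exact absurd (h.φ_mem_int (z := (r', 1 / 2)) ⟨hx.1.trans hx'.2, H⟩ half)
        (h'.φ_end_not_mem_int (.inr rfl) half)

/-- The image of a strip in the `j`-th rectangle is `[0, 1] × [lo, hi]`. -/
lemma IsStrip.exists_image (h : 𝓡.IsStrip i j l r) : ∃ lo hi : ℝ, 0 ≤ lo ∧ lo < hi ∧ hi ≤ 1 ∧
    f.dilatation * 𝓡.height j * (hi - lo) = 𝓡.height i ∧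
    ∀ y ∈ Ioo lo hi, ∃ z, z.1 ∈ Ioo l r ∧ z.2 ∈ Ioo (0 : ℝ) 1 ∧
      f.φ ((𝓡.rect i).ρ z) = (𝓡.rect j).ρ (1 / 2, y) := by
  obtain ⟨-, hlr, -, m, c, k, d, hm, hk, -, hiff, hy, heq⟩ := h
  have hlam := dilatation_pos (f := f)
  have hj := 𝓡.height_pos j
  have hk0 : k ≠ 0 := abs_pos.1 (hk ▸ by have := 𝓡.height_pos i; positivity)
  have hm0 : m ≠ 0 := abs_pos.1
    (hm ▸ by have := 𝓡.width_pos i; have := 𝓡.width_pos j; positivity)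
  obtain ⟨x₀, hx₀⟩ : ∃ x₀, m * x₀ + c = 1 / 2 := ⟨(1 / 2 - c) / m, by field_simp; ring⟩
  have hx₀' : x₀ ∈ Ioo l r := (hiff _).1 (by rw [hx₀]; norm_num)
  have h0 := affine_mem_Icc hy (y := 0) (by simp)
  have h1 := affine_mem_Icc hy (y := 1) (by simp)
  have hfin : ∀ y y' : ℝ, y' ∈ Ioo (0 : ℝ) 1 → k * y' + d = y → ∃ z : ℝ × ℝ, z.1 ∈ Ioo l r ∧
      z.2 ∈ Ioo (0 : ℝ) 1 ∧ f.φ ((𝓡.rect i).ρ z) = (𝓡.rect j).ρ (1 / 2, y) := by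
    intro y y' hy' hyy
    refine ⟨(x₀, y'), hx₀', hy', ?_⟩
    rw [heq _ ⟨Ioo_subset_Icc_self hx₀', Ioo_subset_Icc_self hy'⟩, hx₀, hyy]
  rcases hk0.lt_or_gt with hneg | hpos
  · rw [abs_of_neg hneg] at hk
    refine ⟨k + d, d, by linarith [h1.1], by linarith, by linarith [h0.2], ?_, fun y hyy => ?_⟩
    · rw [show d - (k + d) = -k by ring, hk]; field_simp
    · refine hfin y ((y - d) / k) ⟨?_, ?_⟩ (by field_simp; ring)
      · exact div_pos_of_neg_of_neg (by linarith [hyy.2]) hneg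
      · rw [div_lt_one_of_neg hneg]; linarith [hyy.1]
  · rw [abs_of_pos hpos] at hk
    refine ⟨d, k + d, by linarith [h0.1], by linarith, by linarith [h1.2], ?_, fun y hyy => ?_⟩
    · rw [show k + d - d = k by ring, hk]; field_simp
    · refine hfin y ((y - d) / k) ⟨?_, ?_⟩ (by field_simp; ring)
      · exact div_pos (by linarith [hyy.1]) hpos
      · rw [div_lt_one hpos]; linarith [hyy.2]

end MarkovPartition

/-! ### The transition matrix -/

lemma sum_length_le_one {ι : Type*} {s : Finset ι} {l r : ι → ℝ} (h0 : ∀ i ∈ s, 0 ≤ l i)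
    (hlr : ∀ i ∈ s, l i ≤ r i) (h1 : ∀ i ∈ s, r i ≤ 1)
    (hd : (s : Set ι).PairwiseDisjoint fun i => Ioo (l i) (r i)) :
    ∑ i ∈ s, (r i - l i) ≤ 1 := by
  have h := MeasureTheory.measure_mono (μ := MeasureTheory.volume)
    (show ⋃ i ∈ s, Ioo (l i) (r i) ⊆ Icc (0 : ℝ) 1 from
      iUnion₂_subset fun i hi x hx => ⟨(h0 i hi).trans hx.1.le, hx.2.le.trans (h1 i hi)⟩)
  rw [MeasureTheory.measure_biUnion_finset hd fun _ _ => measurableSet_Ioo] at h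
  simp only [Real.volume_Ioo, Real.volume_Icc] at h
  rw [← ENNReal.ofReal_sum_of_nonneg fun i hi => sub_nonneg.2 (hlr i hi),
    ENNReal.ofReal_le_ofReal_iff (by norm_num)] at h
  simpa using h

lemma one_le_sum_length {ι : Type*} {s : Finset ι} {l r : ι → ℝ}
    (hlr : ∀ i ∈ s, l i ≤ r i) (hcov : Ioo (0 : ℝ) 1 ⊆ ⋃ i ∈ s, Icc (l i) (r i)) :
    1 ≤ ∑ i ∈ s, (r i - l i) := by
  have h := (MeasureTheory.measure_mono (μ := MeasureTheory.volume) hcov).trans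
    (MeasureTheory.measure_biUnion_finset_le s _)
  simp only [Real.volume_Ioo, Real.volume_Icc] at h
  rw [← ENNReal.ofReal_sum_of_nonneg fun i hi => sub_nonneg.2 (hlr i hi),
    ENNReal.ofReal_le_ofReal_iff (Finset.sum_nonneg fun i hi => sub_nonneg.2 (hlr i hi))] at h
  simpa using h

namespace Rectangle

variable {q : FlatConeStructure S M} (R : Rectangle q)

/-- The parametrization of a rectangle is open at interior points. -/
lemma nhds_le_map {w : ℝ × ℝ} (hw : w ∈ openSquare) : 𝓝 (R.ρ w) ≤ map R.ρ (𝓝 w) := by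
  obtain ⟨e, he, hwe⟩ := q.covers _ (R.interior_regular w hw)
  obtain ⟨ε, c, hε, hev⟩ := R.affine_scale (openSquare_subset_square hw) he hwe
  rw [nhdsWithin_square hw] at hev
  have hρ : Tendsto R.ρ (𝓝 w) (𝓝 (R.ρ w)) := by
    have := R.continuousOn w (openSquare_subset_square hw)
    rwa [ContinuousWithinAt, nhdsWithin_square hw] at this
  have ha := R.scaleX_ne
  have hb := R.scaleY_ne
  obtain ⟨σ, hσ, rfl⟩ : ∃ σ : ℝ, (σ = 1 ∨ σ = -1) ∧ ε = σ := by
    rcases hε with rfl | rfl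
    · exact ⟨1, .inl rfl, by simp⟩
    · exact ⟨-1, .inr rfl, by simp⟩
  have hσσ : σ * σ = 1 := by rcases hσ with rfl | rfl <;> norm_num
  set t : S → ℝ × ℝ := fun p =>
    (σ * (e p - c).re / R.scaleX, σ * (e p - c).im / R.scaleY) with ht
  have hw0 : e (R.ρ w) = σ * ⟨R.scaleX * w.1, R.scaleY * w.2⟩ + c := hev.self_of_nhds
  have htw : t (R.ρ w) = w := by
    simp only [t, hw0]
    ext
    · simp
      field_simp
      linear_combination w.1 * hσσ
    · simp
      field_simp
      linear_combination w.2 * hσσ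
  have htt : Tendsto t (𝓝 (R.ρ w)) (𝓝 w) := by
    have he' : Tendsto e (𝓝 (R.ρ w)) (𝓝 (e (R.ρ w))) := e.continuousAt hwe
    have hcont : Continuous (fun x : ℂ =>
        ((σ * (x - c).re / R.scaleX, σ * (x - c).im / R.scaleY) : ℝ × ℝ)) := by fun_prop
    have h₀ : Tendsto t (𝓝 (R.ρ w)) (𝓝 (t (R.ρ w))) := (hcont.tendsto _).comp he'
    rwa [htw] at h₀
  have hrinv : ∀ᶠ p in 𝓝 (R.ρ w), R.ρ (t p) = p := by
    filter_upwards [htt.eventually hev, e.open_source.mem_nhds hwe,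
      (hρ.comp htt).eventually (e.open_source.mem_nhds hwe)] with p h₁ h₂ h₃
    refine e.injOn h₃ h₂ ?_
    refine Eq.trans h₁ ?_
    apply Complex.ext
    · simp [t]
      field_simp
      linear_combination ((e p).re - c.re) * hσσ
    · simp [t]
      field_simp
      linear_combination ((e p).im - c.im) * hσσ
  intro U hU
  filter_upwards [htt hU, hrinv] with p hp hp'
  rw [← hp']
  exact hp

lemma carrier_subset_closure_int : R.carrier ⊆ closure R.int :=
  (image_mono square_subset_closure_openSquare).trans
    (ContinuousOn.image_closure (R.continuousOn.mono
      (closure_minimal openSquare_subset_square (isClosed_Icc.prod isClosed_Icc))))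

lemma carrier_eq_closure_int [T2Space S] : R.carrier = closure R.int :=
  R.carrier_subset_closure_int.antisymm <|
    closure_minimal (image_mono openSquare_subset_square)
      ((isCompact_Icc.prod isCompact_Icc).image_of_continuousOn R.continuousOn).isClosed

end Rectangle

namespace MarkovPartition

variable {f : PseudoAnosov S M} (𝓡 : MarkovPartition f)

/-- The strips joining two given rectangles all have the same width. -/
lemma finite_strips (i j : Fin 𝓡.n) : {p : ℝ × ℝ | 𝓡.IsStrip i j p.1 p.2}.Finite := by
  by_contra hinf
  have hi := 𝓡.width_pos i
  have hj := 𝓡.width_pos j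
  have hlam := dilatation_pos (f := f)
  obtain ⟨N, hN⟩ := exists_nat_gt (f.dilatation * 𝓡.width i / 𝓡.width j)
  obtain ⟨t, ht, hcard⟩ := Set.Infinite.exists_subset_card_eq hinf N
  have hs : ∀ p ∈ t, 𝓡.IsStrip i j p.1 p.2 := fun p hp => ht hp
  have h := sum_length_le_one (s := t) (l := Prod.fst) (r := Prod.snd) (fun p hp => (hs p hp).1)
    (fun p hp => (hs p hp).2.1.le) (fun p hp => (hs p hp).2.2.1) (by
      intro p hp p' hp' hne
      refine disjoint_left.2 fun x hx hx' => hne ?_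
      obtain ⟨-, h₁, h₂⟩ := (hs p hp).eq_of_mem (hs p' hp') hx hx'
      exact Prod.ext h₁ h₂)
  have h' : f.dilatation * 𝓡.width i * ∑ p ∈ t, (p.2 - p.1) = N * 𝓡.width j := by
    rw [Finset.mul_sum, Finset.sum_congr rfl fun p hp => (hs p hp).length, Finset.sum_const, hcard,
      nsmul_eq_mul]
  rw [div_lt_iff₀ hj] at hN
  nlinarith [mul_pos hlam hi]

/-- The strips of the `i`-th rectangle that are mapped into the `j`-th one, as pairs of
endpoints. -/
noncomputable def strips (i j : Fin 𝓡.n) : Finset (ℝ × ℝ) := (𝓡.finite_strips i j).toFinset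

variable {𝓡} in
lemma mem_strips {i j : Fin 𝓡.n} {p : ℝ × ℝ} : p ∈ 𝓡.strips i j ↔ 𝓡.IsStrip i j p.1 p.2 := by
  simp [strips]

/-- The transition matrix of the Markov partition: the number of strips of the `i`-th rectangle
mapped into the `j`-th one. -/
noncomputable def transition (i j : Fin 𝓡.n) : ℕ := (𝓡.strips i j).card

/-- The strips of a rectangle cover it up to finitely many vertical segments. -/
lemma Ioo_subset_strips [T2Space S] (i : Fin 𝓡.n) :
    Ioo (0 : ℝ) 1 ⊆ ⋃ x ∈ Finset.univ.sigma (𝓡.strips i), Icc x.2.1 x.2.2 := by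
  intro x hx
  set K := ⋃ x ∈ Finset.univ.sigma (𝓡.strips i), Icc x.2.1 x.2.2 with hK
  have hcl : IsClosed K := isClosed_biUnion_finset fun _ _ => isClosed_Icc
  by_contra hxK
  have hw : (x, (1 / 2 : ℝ)) ∈ openSquare := ⟨hx, by norm_num⟩
  have hU : {z : ℝ × ℝ | z ∈ openSquare ∧ z.1 ∉ K} ∈ 𝓝 (x, (1 / 2 : ℝ)) :=
    inter_mem (isOpen_openSquare.mem_nhds hw)
      (continuous_fst.continuousAt.preimage_mem_nhds
        (hcl.isOpen_compl.mem_nhds (show x ∈ Kᶜ from hxK)))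
  -- Near `φ (ρ (x, 1 / 2))` all points are images of points outside the strips; some lie in the
  -- interior of a rectangle.
  have hV := (𝓡.rect i).nhds_le_map hw (image_mem_map hU)
  have hV' := f.φ.isOpenMap.image_mem_nhds hV
  have hp : f.φ ((𝓡.rect i).ρ (x, 1 / 2)) ∈ ⋃ j, (𝓡.rect j).carrier :=
    𝓡.covers ▸ mem_univ _
  obtain ⟨j, hj⟩ := mem_iUnion.1 hp
  obtain ⟨p, ⟨_, ⟨z, ⟨hz, hz'⟩, rfl⟩, rfl⟩, hpj⟩ :=
    mem_closure_iff_nhds.1 ((𝓡.rect j).carrier_subset_closure_int hj) _ hV'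
  obtain ⟨l, r, hs, hzs⟩ := 𝓡.exists_isStrip hz hpj
  refine hz' (mem_iUnion₂.2 ⟨⟨j, (l, r)⟩, ?_, Ioo_subset_Icc_self hzs⟩)
  simpa [mem_strips] using hs

/-- The strips of the `i`-th rectangle have total width that of the rectangle. The widths of the
rectangles thus form an eigenvector of the transition matrix for the dilatation. -/
lemma transition_mul_width [T2Space S] (i : Fin 𝓡.n) :
    ∑ j, (𝓡.transition i j : ℝ) * 𝓡.width j = f.dilatation * 𝓡.width i := by
  have hs : ∀ x ∈ Finset.univ.sigma (𝓡.strips i), 𝓡.IsStrip i x.1 x.2.1 x.2.2 := fun x hx =>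
    mem_strips.1 (Finset.mem_sigma.1 hx).2
  have hsum : ∑ x ∈ Finset.univ.sigma (𝓡.strips i), (x.2.2 - x.2.1) = 1 := by
    refine le_antisymm (sum_length_le_one (fun x hx => (hs x hx).1) (fun x hx => (hs x hx).2.1.le)
      (fun x hx => (hs x hx).2.2.1) ?_)
      (one_le_sum_length (fun x hx => (hs x hx).2.1.le) (𝓡.Ioo_subset_strips i))
    intro p hp p' hp' hne
    refine disjoint_left.2 fun x hx hx' => hne ?_
    obtain ⟨h₀, h₁, h₂⟩ := (hs p hp).eq_of_mem (hs p' hp') hx hx'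
    exact Sigma.ext h₀ (heq_of_eq (Prod.ext h₁ h₂))
  rw [← mul_one (f.dilatation * 𝓡.width i), ← hsum, Finset.mul_sum, Finset.sum_sigma]
  refine Finset.sum_congr rfl fun j _ => ?_
  rw [Finset.sum_congr rfl fun p hp => (mem_strips.1 hp).length, Finset.sum_const, nsmul_eq_mul,
    transition]

/-- The images of the strips in the `j`-th rectangle are disjoint, so their heights add up to at
most the height of that rectangle. -/
lemma sum_transition_mul_height_le (j : Fin 𝓡.n) :
    ∑ i, (𝓡.transition i j : ℝ) * 𝓡.height i ≤ f.dilatation * 𝓡.height j := by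
  set T : Finset ((_ : Fin 𝓡.n) × (ℝ × ℝ)) := Finset.univ.sigma fun i => 𝓡.strips i j with hT
  have hs : ∀ x ∈ T, 𝓡.IsStrip x.1 j x.2.1 x.2.2 := fun x hx =>
    mem_strips.1 (Finset.mem_sigma.1 hx).2
  have hex : ∀ x : (_ : Fin 𝓡.n) × (ℝ × ℝ), ∃ lo hi : ℝ, x ∈ T → 0 ≤ lo ∧ lo < hi ∧ hi ≤ 1 ∧
      f.dilatation * 𝓡.height j * (hi - lo) = 𝓡.height x.1 ∧
      ∀ y ∈ Ioo lo hi, ∃ z, z.1 ∈ Ioo x.2.1 x.2.2 ∧ z.2 ∈ Ioo (0 : ℝ) 1 ∧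
        f.φ ((𝓡.rect x.1).ρ z) = (𝓡.rect j).ρ (1 / 2, y) := by
    intro x
    by_cases hx : x ∈ T
    · obtain ⟨lo, hi, h⟩ := (hs x hx).exists_image
      exact ⟨lo, hi, fun _ => h⟩
    · exact ⟨0, 0, fun h => absurd h hx⟩
  choose lo hi h using hex
  have hlam := dilatation_pos (f := f)
  have hj := 𝓡.height_pos j
  have hsum : ∑ x ∈ T, (hi x - lo x) ≤ 1 := by
    refine sum_length_le_one (fun x hx => (h x hx).1) (fun x hx => (h x hx).2.1.le)
      (fun x hx => (h x hx).2.2.1) ?_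
    intro p hp p' hp' hne
    refine disjoint_left.2 fun y hy hy' => hne ?_
    obtain ⟨z, hz, hz₂, hzeq⟩ := (h p hp).2.2.2.2 y hy
    obtain ⟨z', hz', hz₂', hzeq'⟩ := (h p' hp').2.2.2.2 y hy'
    have ho : z ∈ openSquare :=
      ⟨⟨(hs p hp).1.trans_lt hz.1, hz.2.trans_le (hs p hp).2.2.1⟩, hz₂⟩
    have ho' : z' ∈ openSquare :=
      ⟨⟨(hs p' hp').1.trans_lt hz'.1, hz'.2.trans_le (hs p' hp').2.2.1⟩, hz₂'⟩
    obtain ⟨hii, rfl⟩ := 𝓡.eq_of_ρ_eq ho (openSquare_subset_square ho')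
      (f.φ.injective (hzeq.trans hzeq'.symm))
    have hs' := hs p' hp'
    rw [← hii] at hs'
    obtain ⟨-, h₁, h₂⟩ := (hs p hp).eq_of_mem hs' hz hz'
    exact Sigma.ext hii (heq_of_eq (Prod.ext h₁ h₂))
  have hmul := mul_le_mul_of_nonneg_left hsum (mul_pos hlam hj).le
  rw [mul_one, Finset.mul_sum, Finset.sum_congr rfl fun x hx => (h x hx).2.2.2.1, hT,
    Finset.sum_sigma] at hmul
  simpa [transition] using hmul

/-! ### Degrees, targets and mixed rectangles in terms of the transition matrix -/

variable {𝓡} in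
lemma transition_pos {i j : Fin 𝓡.n} {l r : ℝ} (h : 𝓡.IsStrip i j l r) : 0 < 𝓡.transition i j :=
  Finset.card_pos.2 ⟨(l, r), mem_strips.2 h⟩

/-- Each strip is connected, so that there are at most as many components as strips. -/
lemma interiorDegree_le [T2Space S] (i : Fin 𝓡.n) :
    𝓡.interiorDegree i ≤ ((∑ j, 𝓡.transition i j : ℕ) : ℕ∞) := by
  set X : Set S := f.φ ⁻¹' (⋃ j, (𝓡.rect j).int) ∩ (𝓡.rect i).int with hX
  let T := Σ j, 𝓡.strips i j
  have hs : ∀ x : T, 𝓡.IsStrip i x.1 x.2.1.1 x.2.1.2 := fun x => mem_strips.1 x.2.2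
  have hmem : ∀ (x : T) (z : ℝ × ℝ), z ∈ Ioo x.2.1.1 x.2.1.2 ×ˢ Ioo (0 : ℝ) 1 →
      (𝓡.rect i).ρ z ∈ X := fun x z hz =>
    ⟨mem_iUnion.2 ⟨x.1, (hs x).φ_mem_int hz.1 hz.2⟩, mem_image_of_mem _
      ⟨⟨(hs x).1.trans_lt hz.1.1, hz.1.2.trans_le (hs x).2.2.1⟩, hz.2⟩⟩
  have hmid : ∀ x : T, ((x.2.1.1 + x.2.1.2) / 2, (1 / 2 : ℝ)) ∈
      Ioo x.2.1.1 x.2.1.2 ×ˢ Ioo (0 : ℝ) 1 := fun x => by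
    have := (hs x).2.1
    refine ⟨⟨?_, ?_⟩, by norm_num⟩ <;> simp only <;> linarith
  let F : T → ConnectedComponents X := fun x => ((⟨_, hmem x _ (hmid x)⟩ : X) : ConnectedComponents X)
  have hF : Function.Surjective F := by
    intro y
    obtain ⟨⟨p, hp, w, hw, rfl⟩, rfl⟩ := ConnectedComponents.surjective_coe y
    obtain ⟨j, hj⟩ := mem_iUnion.1 hp
    obtain ⟨l, r, hlr, hwl⟩ := 𝓡.exists_isStrip hw hj
    let x : T := ⟨j, (l, r), mem_strips.2 hlr⟩
    refine ⟨x, ConnectedComponents.coe_eq_coe'.2 ?_⟩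
    let Q : Set X := Subtype.val ⁻¹' ((𝓡.rect i).ρ '' (Ioo l r ×ˢ Ioo (0 : ℝ) 1))
    have hQ : IsPreconnected Q := by
      rw [← Topology.IsInducing.subtypeVal.isPreconnected_image]
      rw [Subtype.image_preimage_coe, inter_eq_right.2 (by
        rintro _ ⟨z, hz, rfl⟩; exact hmem x z hz)]
      refine (((convex_Ioo _ _).prod (convex_Ioo _ _)).isPreconnected).image _
        ((𝓡.rect i).continuousOn.mono ?_)
      exact prod_mono (fun t ht => ⟨hlr.1.trans ht.1.le, ht.2.le.trans hlr.2.2.1⟩)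
        Ioo_subset_Icc_self
    exact hQ.subset_connectedComponent (show _ ∈ Q from ⟨w, ⟨hwl, hw.2⟩, rfl⟩)
      (show _ ∈ Q from ⟨_, hmid x, rfl⟩)
  calc 𝓡.interiorDegree i ≤ ENat.card T :=
        ENat.card_le_card_of_injective (Function.injective_surjInv hF)
    _ = ((∑ j, 𝓡.transition i j : ℕ) : ℕ∞) := by
        rw [ENat.card_eq_coe_fintype_card, Fintype.card_sigma]
        simp [transition]

/-- Every component counted in the closed rectangle meets the interior. -/
lemma degree_le_interiorDegree (i : Fin 𝓡.n) : 𝓡.degree i ≤ 𝓡.interiorDegree i := by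
  set O : Set S := f.φ ⁻¹' (⋃ j, (𝓡.rect j).int) with hO
  have hOo : IsOpen O :=
    (isOpen_iUnion fun j => (𝓡.rect j).isOpen_image).preimage f.φ.continuous
  have hsub : O ∩ (𝓡.rect i).int ⊆ O ∩ (𝓡.rect i).carrier :=
    inter_subset_inter_right _ (image_mono openSquare_subset_square)
  let F : ConnectedComponents ↥(O ∩ (𝓡.rect i).int) →
      ConnectedComponents ↥(O ∩ (𝓡.rect i).carrier) :=
    (continuous_inclusion hsub).connectedComponentsMap
  have hF : Function.Surjective F := by
    intro y
    obtain ⟨⟨p, hp, w, hw, rfl⟩, rfl⟩ := ConnectedComponents.surjective_coe y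
    have hnhds : ∀ᶠ z in 𝓝[square] w, (𝓡.rect i).ρ z ∈ O :=
      ((𝓡.rect i).continuousOn w hw).eventually (hOo.mem_nhds hp)
    obtain ⟨ε, hε, hball⟩ := Metric.mem_nhdsWithin_iff.1 hnhds
    obtain ⟨v, hvo, hv⟩ := Metric.mem_closure_iff.1 (square_subset_closure_openSquare hw) ε hε
    have hvb : v ∈ Metric.ball w ε := by rwa [Metric.mem_ball, dist_comm]
    have hvi : (𝓡.rect i).ρ v ∈ O ∩ (𝓡.rect i).int :=
      ⟨hball ⟨hvb, openSquare_subset_square hvo⟩, mem_image_of_mem _ hvo⟩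
    refine ⟨((⟨_, hvi⟩ : ↥(O ∩ (𝓡.rect i).int)) : ConnectedComponents _), ?_⟩
    refine ConnectedComponents.coe_eq_coe'.2 ?_
    -- The part of the rectangle near `w` is connected and contains interior points.
    let Q : Set ↥(O ∩ (𝓡.rect i).carrier) :=
      Subtype.val ⁻¹' ((𝓡.rect i).ρ '' (Metric.ball w ε ∩ square))
    have hQ : IsPreconnected Q := by
      rw [← Topology.IsInducing.subtypeVal.isPreconnected_image]
      rw [Subtype.image_preimage_coe, inter_eq_right.2 (by
        rintro _ ⟨z, hz, rfl⟩; exact ⟨hball hz, mem_image_of_mem _ hz.2⟩)]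
      refine IsPreconnected.image ?_ _ ((𝓡.rect i).continuousOn.mono inter_subset_right)
      exact ((convex_ball w ε).inter ((convex_Icc _ _).prod (convex_Icc _ _))).isPreconnected
    exact hQ.subset_connectedComponent
      (show _ ∈ Q from ⟨w, ⟨Metric.mem_ball_self hε, hw⟩, rfl⟩)
      (show _ ∈ Q from ⟨v, ⟨hvb, openSquare_subset_square hvo⟩, rfl⟩)
  exact ENat.card_le_card_of_injective (Function.injective_surjInv hF)

lemma IsTarget.transition_pos [T2Space S] {i j : Fin 𝓡.n} (h : 𝓡.IsTarget i j) :
    0 < 𝓡.transition i j := by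
  obtain ⟨x, hx, hxi⟩ := h
  obtain ⟨_, hp, w, hw, rfl⟩ := mem_closure_iff.1 ((𝓡.rect i).carrier_subset_closure_int hxi) _
    ((𝓡.rect j).isOpen_image.preimage f.φ.continuous) hx
  obtain ⟨l, r, hs, -⟩ := 𝓡.exists_isStrip hw hp
  exact MarkovPartition.transition_pos hs

/-- If the `i`-th rectangle has a strip mapped into the `j`-th one, and the dimensions of the two
rectangles are those of `R` and `φ(R)`, then the strip is all of the `i`-th rectangle and its image
all of the `j`-th one. -/
lemma unmixed_of_transition_pos [T2Space S] {i j : Fin 𝓡.n} (h : 0 < 𝓡.transition i j)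
    (hw : f.dilatation * 𝓡.width i = 𝓡.width j)
    (hh : f.dilatation * 𝓡.height j = 𝓡.height i) : 𝓡.Unmixed i := by
  obtain ⟨⟨l, r⟩, hp⟩ := Finset.card_pos.1 h
  have hs := mem_strips.1 hp
  have hj := 𝓡.width_pos j
  have hi := 𝓡.height_pos i
  have hlen := hs.length
  rw [hw] at hlen
  simp only at hs hlen
  have hrl : r - l = 1 := by
    have : 𝓡.width j * (r - l) = 𝓡.width j * 1 := by rw [hlen, mul_one]
    exact mul_left_cancel₀ hj.ne' this
  have hl : l = 0 := by linarith [hs.1, hs.2.2.1]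
  have hr : r = 1 := by linarith [hs.1, hs.2.2.1]
  subst hl hr
  obtain ⟨-, -, -, m, c, k, d, hm, hk, -, hiff, hy, heq⟩ := hs
  have hm0 : m ≠ 0 := by
    rw [← abs_pos, hm, hw]; positivity
  have hk1 : |k| = 1 := by rw [hk, hh, div_self hi.ne']
  have h0 := affine_mem_Icc hy (y := 0) (by simp)
  have h1 := affine_mem_Icc hy (y := 1) (by simp)
  have hint : f.φ '' (𝓡.rect i).int = (𝓡.rect j).int := by
    apply subset_antisymm
    · rintro _ ⟨_, ⟨z, hz, rfl⟩, rfl⟩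
      rw [heq z (openSquare_subset_square hz)]
      exact mem_image_of_mem _ ⟨(hiff _).2 hz.1, hy _ hz.2⟩
    · rintro _ ⟨⟨x, y⟩, ⟨hx, hyy⟩, rfl⟩
      have hx' : (x - c) / m ∈ Ioo (0 : ℝ) 1 :=
        (hiff _).1 (by rwa [mul_div_cancel₀ _ hm0, sub_add_cancel])
      obtain ⟨y', hy', hyy'⟩ : ∃ y' ∈ Ioo (0 : ℝ) 1, k * y' + d = y := by
        rcases abs_eq (zero_le_one' ℝ) |>.1 hk1 with rfl | rfl
        · have : d = 0 := by linarith [h0.1, h1.2]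
          exact ⟨y, hyy, by simp [this]⟩
        · have : d = 1 := by linarith [h0.2, h1.1]
          exact ⟨1 - y, ⟨by linarith [hyy.2], by linarith [hyy.1]⟩, by rw [this]; ring⟩
      have hz : ((x - c) / m, y') ∈ openSquare := ⟨hx', hy'⟩
      refine ⟨_, mem_image_of_mem _ hz, ?_⟩
      rw [heq _ (openSquare_subset_square hz), mul_div_cancel₀ _ hm0, sub_add_cancel, hyy']
  refine ⟨j, ?_, hint⟩
  rw [Rectangle.carrier_eq_closure_int, Rectangle.carrier_eq_closure_int, ← hint,
    f.φ.image_closure]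

end MarkovPartition

/-! ### Nonnegative integer matrices with small growth rate -/

section Matrix

variable {ι : Type*} [Fintype ι] {A : Matrix ι ι ℕ} {a b : ι → ℝ} {μ : ℝ}

/-- If `a` is a positive right eigenvector and `b` a positive left sub-eigenvector, then a set that
no transition leaves is one that no transition enters. For rectangles of widths `a` and heights
`b`, this says that an area preserving map of a set into itself is onto. -/
lemma mem_of_transition_mem [DecidableEq ι] (ha : ∀ i, 0 < a i) (hb : ∀ i, 0 < b i)
    (hA : ∀ i, ∑ j, (A i j : ℝ) * a j = μ * a i) (hB : ∀ j, ∑ i, (A i j : ℝ) * b i ≤ μ * b j)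
    {Z : Finset ι} (hZ : ∀ i ∈ Z, ∀ j, A i j ≠ 0 → j ∈ Z) {i j : ι} (hj : j ∈ Z)
    (hij : A i j ≠ 0) : i ∈ Z := by
  by_contra hi
  have h₁ : ∑ j ∈ Z, a j * ∑ i, (A i j : ℝ) * b i ≤ ∑ j ∈ Z, a j * (μ * b j) :=
    Finset.sum_le_sum fun j _ => mul_le_mul_of_nonneg_left (hB j) (ha j).le
  have h₂ : ∑ j ∈ Z, a j * ∑ i ∈ Z, (A i j : ℝ) * b i = ∑ j ∈ Z, a j * (μ * b j) := by
    calc ∑ j ∈ Z, a j * ∑ i ∈ Z, (A i j : ℝ) * b i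
        = ∑ i ∈ Z, b i * ∑ j ∈ Z, (A i j : ℝ) * a j := by
          simp_rw [Finset.mul_sum]
          rw [Finset.sum_comm]
          exact Finset.sum_congr rfl fun _ _ => Finset.sum_congr rfl fun _ _ => by ring
      _ = ∑ i ∈ Z, b i * ∑ j, (A i j : ℝ) * a j := by
          refine Finset.sum_congr rfl fun i hi => ?_
          congr 1
          refine Finset.sum_subset (Finset.subset_univ _) fun j _ hj => ?_
          rw [not_not.1 fun h => hj (hZ i hi j h)]
          simp
      _ = ∑ j ∈ Z, a j * (μ * b j) :=
          Finset.sum_congr rfl fun i _ => by rw [hA]; ring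
  have h₃ : ∑ j ∈ Z, a j * ∑ i ∈ Z, (A i j : ℝ) * b i <
      ∑ j ∈ Z, a j * ∑ i, (A i j : ℝ) * b i := by
    refine Finset.sum_lt_sum (fun j _ => ?_) ⟨j, hj, ?_⟩
    · refine mul_le_mul_of_nonneg_left ?_ (ha j).le
      exact Finset.sum_le_univ_sum_of_nonneg fun i => mul_nonneg (Nat.cast_nonneg _) (hb i).le
    · refine mul_lt_mul_of_pos_left ?_ (ha j)
      exact Finset.sum_lt_sum_of_subset (Finset.subset_univ _) (Finset.mem_univ i) hi
        (mul_pos (Nat.cast_pos.2 (Nat.pos_of_ne_zero hij)) (hb i))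
        fun i _ _ => mul_nonneg (Nat.cast_nonneg _) (hb i).le
  linarith

lemma sum_mul_eq_of_le (ha : ∀ i, 0 < a i)
    (hA : ∀ i, ∑ j, (A i j : ℝ) * a j = μ * a i) (hB : ∀ j, ∑ i, (A i j : ℝ) * b i ≤ μ * b j)
    (j : ι) : ∑ i, (A i j : ℝ) * b i = μ * b j := by
  have h : ∑ j, a j * ∑ i, (A i j : ℝ) * b i = ∑ j, a j * (μ * b j) := by
    calc ∑ j, a j * ∑ i, (A i j : ℝ) * b i = ∑ i, b i * ∑ j, (A i j : ℝ) * a j := by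
          simp_rw [Finset.mul_sum]
          rw [Finset.sum_comm]
          exact Finset.sum_congr rfl fun _ _ => Finset.sum_congr rfl fun _ _ => by ring
      _ = ∑ j, a j * (μ * b j) := Finset.sum_congr rfl fun i _ => by rw [hA]; ring
  have := (Finset.sum_eq_sum_iff_of_le fun j _ =>
    mul_le_mul_of_nonneg_left (hB j) (ha j).le).1 h j (Finset.mem_univ j)
  exact mul_left_cancel₀ (ha j).ne' this

lemma one_le_sum_row (ha : ∀ i, 0 < a i) (hμ : 0 < μ)
    (hA : ∀ i, ∑ j, (A i j : ℝ) * a j = μ * a i) (i : ι) : 1 ≤ ∑ j, A i j := by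
  by_contra! h
  have h0 : ∀ j, A i j = 0 := fun j =>
    (Finset.sum_eq_zero_iff.1 (Nat.lt_one_iff.1 h)) j (Finset.mem_univ j)
  have := hA i
  simp only [h0, Nat.cast_zero, zero_mul, Finset.sum_const_zero] at this
  exact (mul_pos hμ (ha i)).ne this

/-- The number of paths of length `K` from `v` is governed by the excess of the out-degrees at
the vertices visited before time `K`. -/
lemma sum_pow_apply [DecidableEq ι] (A : Matrix ι ι ℕ) (v : ι) (K : ℕ) :
    (∑ j, ((A ^ K) v j : ℝ)) =
      1 + ∑ k ∈ Finset.range K, ∑ j, ((A ^ k) v j : ℝ) * (∑ i, (A j i : ℝ) - 1) := by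
  induction K with
  | zero => simp [Matrix.one_apply]
  | succ K ih =>
    rw [Finset.sum_range_succ, ← add_assoc, ← ih]
    simp only [pow_succ A, Matrix.mul_apply, Nat.cast_sum, Nat.cast_mul]
    rw [Finset.sum_comm, ← Finset.sum_add_distrib]
    refine Finset.sum_congr rfl fun j _ => ?_
    rw [← Finset.mul_sum]
    ring

lemma sum_pow_apply_mul [DecidableEq ι] (hA : ∀ i, ∑ j, (A i j : ℝ) * a j = μ * a i) (v : ι) (K : ℕ) :
    ∑ j, ((A ^ K) v j : ℝ) * a j = μ ^ K * a v := by
  induction K with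
  | zero => simp [Matrix.one_apply]
  | succ K ih =>
    simp only [pow_succ A, Matrix.mul_apply, Nat.cast_sum, Nat.cast_mul, Finset.sum_mul]
    rw [Finset.sum_comm]
    simp only [mul_assoc, ← Finset.mul_sum, hA]
    rw [pow_succ', mul_assoc, ← ih, Finset.mul_sum]
    exact Finset.sum_congr rfl fun _ _ => by ring

/-- The vertices reachable from `v` can all be reached in fewer steps than their number. -/
lemma exists_reachable [DecidableEq ι] (A : Matrix ι ι ℕ) (v : ι) : ∃ W : Finset ι, v ∈ W ∧
    (∀ i ∈ W, ∀ j, A i j ≠ 0 → j ∈ W) ∧ ∀ j ∈ W, ∃ k < W.card, (A ^ k) v j ≠ 0 := by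
  classical
  let R : ℕ → Finset ι := fun K => Finset.univ.filter fun j => ∃ k ≤ K, (A ^ k) v j ≠ 0
  have hmono : ∀ K, R K ⊆ R (K + 1) := fun K j hj => by
    obtain ⟨k, hk, h⟩ := (Finset.mem_filter.1 hj).2
    exact Finset.mem_filter.2 ⟨Finset.mem_univ _, k, hk.trans K.le_succ, h⟩
  have hv : ∀ K, v ∈ R K := fun K =>
    Finset.mem_filter.2 ⟨Finset.mem_univ _, 0, K.zero_le, by simp⟩
  have hcard : ∀ K, (∀ k < K, R k ≠ R (k + 1)) → K + 1 ≤ (R K).card := by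
    intro K
    induction K with
    | zero => exact fun _ => Finset.card_pos.2 ⟨v, hv 0⟩
    | succ K ih =>
      intro h
      have h₁ := ih fun k hk => h k (hk.trans K.lt_succ_self)
      have h₂ := Finset.card_lt_card ((hmono K).ssubset_of_ne (h K K.lt_succ_self))
      omega
  have hex : ∃ K, R K = R (K + 1) := by
    by_contra! h
    have h₁ := hcard (Fintype.card ι) fun k _ => h k
    have h₂ := Finset.card_le_univ (R (Fintype.card ι))
    omega
  refine ⟨R (Nat.find hex), hv _, fun i hi j hij => ?_, fun j hj => ?_⟩
  · rw [Nat.find_spec hex]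
    obtain ⟨k, hk, h⟩ := (Finset.mem_filter.1 hi).2
    refine Finset.mem_filter.2 ⟨Finset.mem_univ _, k + 1, Nat.succ_le_succ hk, ?_⟩
    rw [pow_succ, Matrix.mul_apply]
    exact fun h0 => mul_ne_zero h hij (Finset.sum_eq_zero_iff.1 h0 i (Finset.mem_univ i))
  · obtain ⟨k, hk, h⟩ := (Finset.mem_filter.1 hj).2
    exact ⟨k, lt_of_le_of_lt hk (hcard _ fun k hk => Nat.find_min hex hk), h⟩

lemma mem_of_pow_apply_ne_zero [DecidableEq ι] {U : Finset ι} (hU : ∀ i ∈ U, ∀ j, A i j ≠ 0 → j ∈ U) {v : ι}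
    (hv : v ∈ U) (k : ℕ) {j : ι} (h : (A ^ k) v j ≠ 0) : j ∈ U := by
  induction k generalizing j with
  | zero =>
    rw [pow_zero, Matrix.one_apply] at h
    have : v = j := by by_contra hne; simp [hne] at h
    exact this ▸ hv
  | succ k ih =>
    rw [pow_succ, Matrix.mul_apply] at h
    obtain ⟨i, -, hi⟩ := Finset.exists_ne_zero_of_sum_ne_zero h
    exact hU i (ih (left_ne_zero_of_mul hi)) j (right_ne_zero_of_mul hi)

/-- On a set that no transition leaves, the excess of the out-degrees is at most
`μ ^ card - 1`. For the set of vertices reachable from the vertex `v` of least weight, this holds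
as there are at most `μ ^ K` paths of length `K` from `v`; its complement is treated by
induction. -/
lemma sum_excess_le [DecidableEq ι] (ha : ∀ i, 0 < a i) (hb : ∀ i, 0 < b i) (hμ : 1 ≤ μ)
    (hA : ∀ i, ∑ j, (A i j : ℝ) * a j = μ * a i) (hB : ∀ j, ∑ i, (A i j : ℝ) * b i ≤ μ * b j)
    (U : Finset ι) (hU : ∀ i ∈ U, ∀ j, A i j ≠ 0 → j ∈ U) :
    ∑ i ∈ U, (∑ j, (A i j : ℝ) - 1) ≤ μ ^ U.card - 1 := by
  classical
  induction U using Finset.strongInduction with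
  | H U ih =>
    rcases U.eq_empty_or_nonempty with rfl | hne
    · simp
    obtain ⟨v, hvU, hv⟩ := U.exists_min_image a hne
    obtain ⟨W, hvW, hW, hreach⟩ := exists_reachable A v
    have hWU : W ⊆ U := fun j hj => by
      obtain ⟨k, -, hk⟩ := hreach j hj
      exact mem_of_pow_apply_ne_zero hU hvU k hk
    have hd : ∀ i, (0 : ℝ) ≤ ∑ j, (A i j : ℝ) - 1 := fun i => by
      have := one_le_sum_row ha (one_pos.trans_le hμ) hA i
      have : (1 : ℝ) ≤ (∑ j, A i j : ℕ) := by exact_mod_cast this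
      push_cast at this
      linarith
    have hpaths : ∑ j, ((A ^ W.card) v j : ℝ) ≤ μ ^ W.card := by
      refine le_of_mul_le_mul_right ?_ (ha v)
      rw [← sum_pow_apply_mul hA, Finset.sum_mul]
      refine Finset.sum_le_sum fun j _ => ?_
      by_cases h : (A ^ W.card) v j = 0
      · simp [h]
      · exact mul_le_mul_of_nonneg_left (hv j (mem_of_pow_apply_ne_zero hU hvU _ h))
          (Nat.cast_nonneg _)
    have hWle : ∑ i ∈ W, (∑ j, (A i j : ℝ) - 1) ≤ μ ^ W.card - 1 := by
      refine le_trans ?_ (sub_le_sub_right hpaths 1)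
      rw [sum_pow_apply, add_sub_cancel_left, Finset.sum_comm]
      refine (Finset.sum_le_sum fun j hj => ?_).trans
        (Finset.sum_le_univ_sum_of_nonneg fun j => Finset.sum_nonneg fun k _ =>
          mul_nonneg (Nat.cast_nonneg _) (hd j))
      obtain ⟨k, hk, hkj⟩ := hreach j hj
      refine le_trans ?_ (Finset.single_le_sum (fun k _ => mul_nonneg (Nat.cast_nonneg _) (hd j))
        (Finset.mem_range.2 hk))
      refine le_mul_of_one_le_left (hd j) ?_
      exact_mod_cast Nat.one_le_iff_ne_zero.2 hkj
    have hrest := ih (U \ W) (Finset.sdiff_ssubset hWU ⟨v, hvW⟩) fun i hi j hij =>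
      Finset.mem_sdiff.2 ⟨hU i (Finset.mem_sdiff.1 hi).1 j hij, fun hj =>
        (Finset.mem_sdiff.1 hi).2 (mem_of_transition_mem ha hb hA hB hW hj hij)⟩
    rw [← Finset.sum_sdiff hWU, ← Finset.card_sdiff_add_card_eq_card hWU, pow_add]
    have h₁ := one_le_pow₀ hμ (n := W.card)
    have h₂ := one_le_pow₀ hμ (n := (U \ W).card)
    nlinarith [mul_nonneg (sub_nonneg.2 h₁) (sub_nonneg.2 h₂)]

/-- The bounds for an integer matrix whose row and column sums are positive and exceed `1` by at
most `E` in total. Here `X` consists of vertices that either have several outgoing edges or lead to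
a vertex with several incoming edges, and `Y` of successors of these. -/
lemma card_and_sums_le {E : ℕ} (hrow : ∀ i, 1 ≤ ∑ j, A i j) (hcol : ∀ j, 1 ≤ ∑ i, A i j)
    (hE : ∑ i, (∑ j, A i j - 1) ≤ E) {X Y : Finset ι}
    (hX : ∀ i ∈ X, ∑ j, A i j = 1 → ∀ j, A i j ≠ 0 → ∑ k, A k j ≠ 1)
    (hY : ∀ j ∈ Y, ∃ i ∈ X, A i j ≠ 0) :
    X.card ≤ 3 * E ∧ ∑ i ∈ X, ∑ j, A i j ≤ 4 * E ∧
      ∑ j ∈ Y, ∑ i with A i j ≠ 0, ∑ k, A i k ≤ E ^ 2 + 6 * E := by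
  obtain ⟨e, he⟩ : ∃ e : ι → ℕ, ∀ i, ∑ j, A i j = 1 + e i :=
    ⟨fun i => ∑ j, A i j - 1, fun i => (Nat.add_sub_cancel' (hrow i)).symm⟩
  obtain ⟨g, hg⟩ : ∃ g : ι → ℕ, ∀ j, ∑ i, A i j = 1 + g j :=
    ⟨fun j => ∑ i, A i j - 1, fun j => (Nat.add_sub_cancel' (hcol j)).symm⟩
  simp only [he, Nat.add_sub_cancel_left] at hE
  have hG : ∑ j, g j ≤ E := by
    have h₁ : ∑ i, (1 + e i) = ∑ j, (1 + g j) := by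
      simp only [← he, ← hg]
      exact Finset.sum_comm
    rw [Finset.sum_add_distrib, Finset.sum_add_distrib] at h₁
    omega
  have hXc : X.card ≤ 3 * E := by
    have h₁ : ∀ i ∈ X, 1 ≤ e i + ∑ j, A i j * (if g j = 0 then 0 else 1) := by
      intro i hi
      rcases Nat.eq_zero_or_pos (e i) with h0 | h0
      · have hi1 : ∑ j, A i j = 1 := by rw [he, h0]
        obtain ⟨j, -, hj⟩ := Finset.exists_ne_zero_of_sum_ne_zero (hi1 ▸ one_ne_zero)
        have hgj : g j ≠ 0 := fun h => hX i hi hi1 j hj (by rw [hg, h])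
        have h₂ := Finset.single_le_sum (f := fun j => A i j * (if g j = 0 then 0 else 1))
          (fun _ _ => Nat.zero_le _) (Finset.mem_univ j)
        simp only [hgj, if_false, mul_one] at h₂
        have := Nat.pos_of_ne_zero hj
        omega
      · omega
    calc X.card = ∑ i ∈ X, 1 := by simp
      _ ≤ ∑ i ∈ X, (e i + ∑ j, A i j * (if g j = 0 then 0 else 1)) := Finset.sum_le_sum h₁
      _ ≤ ∑ i, (e i + ∑ j, A i j * (if g j = 0 then 0 else 1)) :=
          Finset.sum_le_sum_of_subset (Finset.subset_univ _)
      _ = ∑ i, e i + ∑ j, (1 + g j) * (if g j = 0 then 0 else 1) := by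
          rw [Finset.sum_add_distrib, Finset.sum_comm (f := fun i j => _)]
          simp only [← Finset.sum_mul, hg]
      _ ≤ E + ∑ j, 2 * g j := by
          refine add_le_add hE (Finset.sum_le_sum fun j _ => ?_)
          split_ifs <;> omega
      _ ≤ 3 * E := by rw [← Finset.mul_sum]; omega
  have hXs : ∑ i ∈ X, ∑ j, A i j ≤ 4 * E := by
    simp only [he, Finset.sum_add_distrib]
    have h₁ : ∑ i ∈ X, e i ≤ ∑ i, e i := Finset.sum_le_sum_of_subset (Finset.subset_univ _)
    simp only [Finset.sum_const, smul_eq_mul, mul_one]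
    omega
  have hYc : Y.card ≤ 4 * E := by
    calc Y.card = ∑ j ∈ Y, 1 := by simp
      _ ≤ ∑ j ∈ Y, ∑ i ∈ X, A i j := by
          refine Finset.sum_le_sum fun j hj => ?_
          obtain ⟨i, hi, hij⟩ := hY j hj
          exact (Nat.one_le_iff_ne_zero.2 hij).trans
            (Finset.single_le_sum (f := fun i => A i j) (fun _ _ => Nat.zero_le _) hi)
      _ ≤ ∑ j, ∑ i ∈ X, A i j := Finset.sum_le_sum_of_subset (Finset.subset_univ _)
      _ = ∑ i ∈ X, ∑ j, A i j := Finset.sum_comm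
      _ ≤ 4 * E := hXs
  refine ⟨hXc, hXs, ?_⟩
  have heE : ∀ i, e i ≤ E := fun i =>
    (Finset.single_le_sum (f := e) (fun _ _ => Nat.zero_le _) (Finset.mem_univ i)).trans hE
  calc ∑ j ∈ Y, ∑ i with A i j ≠ 0, ∑ k, A i k
      ≤ ∑ j ∈ Y, ∑ i, A i j * (1 + e i) := by
        refine Finset.sum_le_sum fun j _ => ?_
        rw [Finset.sum_filter]
        refine Finset.sum_le_sum fun i _ => ?_
        split_ifs with h
        · rw [he]
          exact Nat.le_mul_of_pos_left _ (Nat.pos_of_ne_zero h)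
        · exact Nat.zero_le _
    _ = ∑ j ∈ Y, (1 + g j) + ∑ j ∈ Y, ∑ i, A i j * e i := by
        simp only [mul_add, mul_one, Finset.sum_add_distrib, hg]
    _ ≤ (Y.card + ∑ j, g j) + ∑ j, ∑ i, A i j * e i := by
        refine add_le_add ?_ (Finset.sum_le_sum_of_subset (Finset.subset_univ _))
        rw [Finset.sum_add_distrib]
        refine add_le_add (by simp) (Finset.sum_le_sum_of_subset (Finset.subset_univ _))
    _ = (Y.card + ∑ j, g j) + ∑ i, (1 + e i) * e i := by
        rw [Finset.sum_comm]
        simp only [← Finset.sum_mul, he]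
    _ ≤ (4 * E + E) + ∑ i, (1 + E) * e i := by
        refine add_le_add (add_le_add hYc hG) (Finset.sum_le_sum fun i _ => ?_)
        exact Nat.mul_le_mul_right _ (Nat.add_le_add_left (heE i) 1)
    _ ≤ (4 * E + E) + (1 + E) * E := by
        rw [← Finset.mul_sum]
        exact Nat.add_le_add_left (Nat.mul_le_mul_left _ hE) _
    _ = E ^ 2 + 6 * E := by ring

end Matrix

/-! ### Partitions of small size -/

lemma dilatation_pow_le {P : ℝ} (hP : 1 ≤ P) {f : PseudoAnosov S M} (hf : f ∈ Psi P S M) {n : ℕ}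
    (hn : (n : ℤ) ≤ 9 * |eulerChar S M|) : f.dilatation ^ n ≤ P ^ 9 := by
  have hP0 : 0 < P := one_pos.trans_le hP
  have hχ : (0 : ℝ) < |(eulerChar S M : ℝ)| := abs_pos.2 (Int.cast_ne_zero.2 hf.1.ne)
  have hn' : (n : ℝ) ≤ 9 * |(eulerChar S M : ℝ)| := by exact_mod_cast hn
  calc f.dilatation ^ n ≤ (P ^ (1 / |(eulerChar S M : ℝ)|)) ^ n :=
        pow_le_pow_left₀ (one_pos.trans f.one_lt_dilatation).le hf.2 n
    _ = P ^ (1 / |(eulerChar S M : ℝ)| * n) := by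
        rw [← Real.rpow_natCast, ← Real.rpow_mul hP0.le]
    _ ≤ P ^ (9 : ℝ) := by
        refine Real.rpow_le_rpow_of_exponent_le hP ?_
        rw [one_div, inv_mul_le_iff₀ hχ]
        linarith
    _ = P ^ 9 := by rw [← Real.rpow_natCast]; norm_num

namespace MarkovPartition

variable {f : PseudoAnosov S M} (𝓡 : MarkovPartition f)

/-- The bounds in terms of `E`, for any degree function bounded by the number of strips. -/
lemma bounds_of_pow_le [T2Space S] {E : ℕ} (hE : f.dilatation ^ 𝓡.n - 1 ≤ E) :
    𝓡.mixed.card ≤ 3 * E ∧ ∀ deg : Fin 𝓡.n → ℕ∞,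
      (∀ i, deg i ≤ ((∑ j, 𝓡.transition i j : ℕ) : ℕ∞)) →
      ∑ i ∈ 𝓡.mixed, deg i ≤ ((4 * E : ℕ) : ℕ∞) ∧
        ∑ j ∈ 𝓡.mixedTargets, 𝓡.codegree deg j ≤ ((E ^ 2 + 6 * E : ℕ) : ℕ∞) := by
  classical
  set A : Matrix (Fin 𝓡.n) (Fin 𝓡.n) ℕ := 𝓡.transition with hAdef
  have hlam := dilatation_pos (f := f)
  have hA := 𝓡.transition_mul_width
  have hB := sum_mul_eq_of_le (A := A) 𝓡.width_pos hA 𝓡.sum_transition_mul_height_le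
  have hrow : ∀ i, 1 ≤ ∑ j, A i j := one_le_sum_row 𝓡.width_pos hlam hA
  have hcol : ∀ j, 1 ≤ ∑ i, A i j := one_le_sum_row (A := A.transpose) 𝓡.height_pos hlam hB
  have hsum : ∑ i, (∑ j, A i j - 1) ≤ E := by
    have h := sum_excess_le (A := A) 𝓡.width_pos 𝓡.height_pos f.one_lt_dilatation.le hA
      𝓡.sum_transition_mul_height_le Finset.univ fun _ _ j _ => Finset.mem_univ j
    rw [Finset.card_univ, Fintype.card_fin] at h
    have h' : ((∑ i, (∑ j, A i j - 1) : ℕ) : ℝ) = ∑ i, (∑ j, (A i j : ℝ) - 1) := by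
      push_cast [Nat.cast_sub (hrow _)]
      rfl
    exact_mod_cast h'.le.trans (h.trans hE)
  have hX : ∀ i ∈ 𝓡.mixed, ∑ j, A i j = 1 → ∀ j, A i j ≠ 0 → ∑ k, A k j ≠ 1 := by
    intro i hi hi1 j hij hj1
    refine (Finset.mem_filter.1 hi).2
      (𝓡.unmixed_of_transition_pos (Nat.pos_of_ne_zero hij) ?_ ?_)
    · rw [← hA i]
      have hle := Finset.single_le_sum (f := fun j => A i j) (fun _ _ => Nat.zero_le _)
        (Finset.mem_univ j)
      have h0 : ∀ k ≠ j, A i k = 0 := fun k hk => by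
        have := Finset.add_le_sum (f := fun j => A i j) (fun _ _ => Nat.zero_le _)
          (Finset.mem_univ k) (Finset.mem_univ j) hk
        omega
      rw [Finset.sum_eq_single j (fun k _ hk => by
        rw [show 𝓡.transition i k = 0 from h0 k hk]; simp) (by simp),
        show 𝓡.transition i j = 1 by change A i j = 1; omega]
      simp
    · rw [← hB j]
      have hle := Finset.single_le_sum (f := fun k => A k j) (fun _ _ => Nat.zero_le _)
        (Finset.mem_univ i)
      have h0 : ∀ k ≠ i, A k j = 0 := fun k hk => by
        have := Finset.add_le_sum (f := fun k => A k j) (fun _ _ => Nat.zero_le _)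
          (Finset.mem_univ k) (Finset.mem_univ i) hk
        omega
      rw [Finset.sum_eq_single i (fun k _ hk => by rw [h0 k hk]; simp) (by simp),
        show A i j = 1 by omega]
      simp
  have hY : ∀ j ∈ 𝓡.mixedTargets, ∃ i ∈ 𝓡.mixed, A i j ≠ 0 := by
    intro j hj
    obtain ⟨i, hi, hij⟩ := (Finset.mem_filter.1 hj).2
    exact ⟨i, hi, (hij.transition_pos).ne'⟩
  obtain ⟨h₁, h₂, h₃⟩ := card_and_sums_le hrow hcol hsum hX hY
  refine ⟨h₁, fun deg hdeg => ⟨?_, ?_⟩⟩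
  · refine (Finset.sum_le_sum fun i _ => hdeg i).trans ?_
    exact_mod_cast h₂
  · refine le_trans (b := ((∑ j ∈ 𝓡.mixedTargets, ∑ i with A i j ≠ 0, ∑ k, A i k : ℕ) : ℕ∞)) ?_
      (by exact_mod_cast h₃)
    rw [Nat.cast_sum]
    refine Finset.sum_le_sum fun j _ => ?_
    rw [codegree, Nat.cast_sum]
    refine (Finset.sum_le_sum fun i _ => hdeg i).trans (Finset.sum_le_sum_of_subset fun i hi => ?_)
    exact Finset.mem_filter.2 ⟨Finset.mem_univ _, ((Finset.mem_filter.1 hi).2.transition_pos).ne'⟩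

end MarkovPartition

end SmallDilatation

open SmallDilatation in
theorem lemmaL (P : ℝ) (hP : 1 ≤ P) :
    ∃ C : ℕ, 0 < C ∧
      ∀ (S : Type u) [TopologicalSpace S] [T2Space S] [CompactSpace S] [ConnectedSpace S]
        (M : Finset S) (f : PseudoAnosov S M), f ∈ Psi P S M →
        ∀ 𝓡 : MarkovPartition f, 𝓡.IsSmall →
          𝓡.mixed.card ≤ C ∧
          (∑ i ∈ 𝓡.mixed, 𝓡.degree i ≤ C ∧
            ∑ j ∈ 𝓡.mixedTargets, 𝓡.codegree 𝓡.degree j ≤ C) ∧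
          (∑ i ∈ 𝓡.mixed, 𝓡.interiorDegree i ≤ C ∧
            ∑ j ∈ 𝓡.mixedTargets, 𝓡.codegree 𝓡.interiorDegree j ≤ C) := by
  obtain ⟨E, hE⟩ := exists_nat_ge (P ^ 9)
  have hE0 : 0 < E := by
    have h : (0 : ℝ) < E := (pow_pos (one_pos.trans_le hP) 9).trans_le hE
    exact_mod_cast h
  refine ⟨E ^ 2 + 6 * E, by positivity, ?_⟩
  intro S _ _ _ _ M f hf 𝓡 hsmall
  have hpow : f.dilatation ^ 𝓡.n - 1 ≤ E := by linarith [dilatation_pow_le hP hf hsmall]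
  obtain ⟨hcard, hdeg⟩ := 𝓡.bounds_of_pow_le hpow
  have h4 : ((4 * E : ℕ) : ℕ∞) ≤ ((E ^ 2 + 6 * E : ℕ) : ℕ∞) := by
    exact_mod_cast (show 4 * E ≤ E ^ 2 + 6 * E by nlinarith)
  have hi := hdeg _ 𝓡.interiorDegree_le
  have hd := hdeg _ fun i => (𝓡.degree_le_interiorDegree i).trans (𝓡.interiorDegree_le i)
  exact ⟨hcard.trans (by nlinarith), ⟨hd.1.trans h4, hd.2⟩, ⟨hi.1.trans h4, hi.2⟩⟩
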